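/- Let $(\Omega,\mathcal F,\mathbb P)$ be a probability space, $0\le T<\infty$, and let $\mathbb F=(\mathcal F_t)_{0\le t\le T}$ and $\mathbb H=(\mathcal H_t)_{0\le t\le T}$ be filtrations satisfying the usual hypotheses of completeness and right-continuity, with $\mathcal H_t\subseteq\mathcal F_t$ for every $t$. A process $X=(X_t)_{0\le t\le T}$ is said to be of integrable variation if $\mathbb E[\|X\|_T]<\infty$, where $\|X\|_T=\sup_\Delta\sum_i|X_{t_{i+1}}-X_{t_i}|$, the supremum being over all finite partitions $\Delta=\{0=t_0<t_1<\dots<t_n=T\}$ of $[0,T]$. For a càdlàg process $X$ of integrable variation, $\int_0^T\varphi_t\,\mathrm dX_t$ is the pathwise Lebesgue–Stieltjes integral over $(0,T]$. A process on $[0,T]$ is $\mathbb H$-predictable if it is measurable with respect to the $\sigma$-algebra on $[0,T]\times\Omega$ generated by the sets $\{0\}\times A$ with $A\in\mathcal H_0$ and $(s,T]\times A$ with $s\in[0,T]$, $A\in\mathcal H_s$. Let $G=(G_t)_{0\le t\le T}$ be a real-valued càdlàg $\mathbb F$-adapted process of integrable variation. Then there exists an $\mathbb H$-predictable càdlàg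 process $G^{\mathbb H}=(G^{\mathbb H}_t)_{0\le t\le T}$ of integrable variation with $G^{\mathbb H}_0=0$ such that $$\mathbb E\Big[\int_0^T\varphi_t\,\mathrm dG^{\mathbb H}_t\Big]=\mathbb E\Big[\int_0^T\varphi_t\,\mathrm dG_t\Big]\qquad\text{for every bounded }\mathbb H\text{-predictable process }\varphi.$$ It is unique up to indistinguishability. More precisely, if $G'$ is any $\mathbb H$-predictable càdlàg process of integrable variation with the same property (with $G'_0$ arbitrary), then, $\mathbb P$-almost surely, $G'_t-G'_0=G^{\mathbb H}_t$ for all $t\in[0,T]$. The process $G^{\mathbb H}$ is called the $\mathbb H$-predictable dual projection of $G$. -/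

import Mathlib

open MeasureTheory Filter Topology
open scoped NNReal ENNReal

namespace PredictableDualProjection

/-- The time interval `[0, T]`, as a subtype of the nonnegative reals. Its least element is
`(⊥ : TimeInterval T)`, that is, time `0`. -/
abbrev TimeInterval (T : ℝ≥0) : Type := Set.Iic T

instance instCompactIccSpaceTimeInterval (T : ℝ≥0) : CompactIccSpace (TimeInterval T) where
  isCompact_Icc {a b} := by
    have : CompactSpace (TimeInterval T) := by
      refine isCompact_iff_compactSpace.mp ?_
      rw [← Set.Icc_bot]
      exact isCompact_Icc
    exact isClosed_Icc.isCompact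

/-- A path on `[0, T]` is càdlàg if it is right-continuous and has a finite left limit at every
time (the second clause is empty at time `0`, the first one at time `T`). -/
def IsCadlag {T : ℝ≥0} (f : TimeInterval T → ℝ) : Prop :=
  ∀ t, ContinuousWithinAt f (Set.Ici t) t ∧ ∃ l : ℝ, Tendsto f (𝓝[<] t) (𝓝 l)

/-- The usual hypotheses: every subset of `Ω` of outer measure zero belongs to the initial
σ-algebra, and the filtration is right-continuous. -/
structure UsualHypotheses {T : ℝ≥0} {Ω : Type*} {m : MeasurableSpace Ω} (P : Measure Ω)
    (𝓕 : Filtration (TimeInterval T) m) : Prop where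
  complete : ∀ N : Set Ω, P N = 0 → MeasurableSet[𝓕 ⊥] N
  rightContinuous : 𝓕.IsRightContinuous

/-- A process has integrable variation if the expectation of the total variation of its paths
over `[0, T]` is finite. -/
def HasIntegrableVariation {T : ℝ≥0} {Ω : Type*} [MeasurableSpace Ω] (P : Measure Ω)
    (G : TimeInterval T → Ω → ℝ) : Prop :=
  ∫⁻ ω, eVariationOn (fun t => G t ω) Set.univ ∂P < ∞

open Classical in
/-- The pathwise Lebesgue-Stieltjes integral `∫₀ᵀ φ_t dg_t` for a path `g` of bounded variation on
`[0, T]`: the integral of `φ` with respect to the signed measure attached to `g`. For a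
right-continuous `g` this measure gives mass `g b - g a` to `(a, b]` and mass `0` to `{0}`, so the
integral is over `(0, T]`. It is set to `0` when `g` is not of bounded variation. -/
noncomputable def stieltjesIntegral {T : ℝ≥0} (φ g : TimeInterval T → ℝ) : ℝ :=
  if hg : BoundedVariationOn g Set.univ then
    hg.vectorMeasure.integral φ (ContinuousLinearMap.lsmul ℝ ℝ)
  else 0

/-- `GH` is an `𝓗`-predictable dual projection of `G`: an `𝓗`-predictable càdlàg process of
integrable variation such that `E[∫₀ᵀ φ_t dGH_t] = E[∫₀ᵀ φ_t dG_t]` for all bounded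
`𝓗`-predictable processes `φ`. -/
structure IsPredictableDualProjection {T : ℝ≥0} {Ω : Type*} {m : MeasurableSpace Ω}
    (P : Measure Ω) (𝓗 : Filtration (TimeInterval T) m) (G GH : TimeInterval T → Ω → ℝ) :
    Prop where
  predictable : IsStronglyPredictable 𝓗 GH
  cadlag : ∀ ω, IsCadlag fun t => GH t ω
  integrableVariation : HasIntegrableVariation P GH
  expectation_eq : ∀ φ : TimeInterval T → Ω → ℝ, IsStronglyPredictable 𝓗 φ →
    (∃ C : ℝ, ∀ t ω, |φ t ω| ≤ C) →
    ∫ ω, stieltjesIntegral (fun t => φ t ω) (fun t => GH t ω) ∂P =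
      ∫ ω, stieltjesIntegral (fun t => φ t ω) (fun t => G t ω) ∂P

end PredictableDualProjection

namespace PredictableDualProjection

/-! Existence. Almost surely `G - G ⊥` is the difference of two integrable increasing processes, the
variation and the variation minus the increments of `G` (`exists_isDecomposition`). It is therefore
enough to find, for an increasing `V`, a predictable increasing `A` whose increments over `(s, T]`
have the same conditional expectation given `𝓗 s` as those of `V`. The Doléans measures of `V` and
`A` then agree on a π-system generating the predictable σ-algebra, hence against all bounded
predictable integrands (`HaveSameProjection.integral_doleans`). Cutting `V` into levels of height
one (`levelPart`) reduces this to `V ⊤ ≤ 1`.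

In the bounded case the conditional increments along the dyadic grids give discrete compensators
whose terminal values are bounded in `L²`. Forward convex combinations of these values converge to
some `g`, fast enough that the combined processes converge almost surely at every dyadic time to
`limComp`, the conditional expectation of `g - (V ⊤ - V t)`. The limsup `B` of the combinations is
predictable and increasing, but need not be right-continuous. Let `A` be its right-continuous
version. Fatou's lemma bounds the integral of `A ⊤ - B` against `dA` by the liminf of the integrals
of the approximations. In expectation these are convex combinations of lower sums of `A` against its
own increments, hence at most the integral of `A ⊤ - A`. Since `B ≤ A`, all inequalities are
equalities, so `B = A` holds `dA`-almost everywhere. This settles the jump times of `A`; elsewhere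
`B` is squeezed by its dyadic values (`eq_of_liminf_le`, `ae_rightLim_limsup_combComp`).

Uniqueness. Let `N` be the difference of two candidates, started at `0`, and let `f x = √(1 + x ^
2)`. Then `f (N t) - f 0` is the integral against `dN` of difference quotients of `f`, which are
bounded by `1`. Up to an error vanishing in the limit they can be replaced by predictable ones,
whose expected integral is zero. Hence `f (N t)` has expectation `1`, and `N t = 0` almost surely.
-/

/-- The `i`-th point of the regular subdivision of `[0, u]` into `2 ^ n` intervals. -/
noncomputable def grid {T : ℝ≥0} (u : TimeInterval T) (n i : ℕ) : TimeInterval T :=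
  ⟨u.1 * (min i (2 ^ n) : ℕ) / 2 ^ n, by
    refine le_trans ?_ (show u.1 ≤ T from u.2)
    rw [div_le_iff₀ (by positivity)]
    gcongr
    exact_mod_cast min_le_right _ _⟩

/-! ### Dyadic subdivisions of `[0, u]`. -/

section Grid

variable {T : ℝ≥0} (u : TimeInterval T)

lemma bot_val : ((⊥ : TimeInterval T) : ℝ≥0) = 0 := rfl

@[simp] lemma grid_zero (n : ℕ) : grid u n 0 = ⊥ := by
  apply Subtype.ext
  simp [grid]

lemma grid_of_le {n i : ℕ} (h : 2 ^ n ≤ i) : grid u n i = u := by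
  apply Subtype.ext
  simp [grid, min_eq_right h]

lemma grid_mono (n : ℕ) : Monotone (grid u n) := by
  intro i j hij
  change (_ : ℝ≥0) ≤ _
  simp only [grid]
  gcongr

lemma grid_le (n i : ℕ) : grid u n i ≤ u := by
  rcases le_total (2 ^ n) i with h | h
  · exact (grid_of_le u h).le
  · exact (grid_mono u n h).trans (grid_of_le u le_rfl).le

lemma grid_refine {n m : ℕ} (h : n ≤ m) (i : ℕ) : grid u m (2 ^ (m - n) * i) = grid u n i := by
  apply Subtype.ext
  obtain ⟨k, rfl⟩ := Nat.exists_eq_add_of_le h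
  simp only [grid, Nat.add_sub_cancel_left]
  have : min (2 ^ k * i) (2 ^ (n + k)) = 2 ^ k * min i (2 ^ n) := by
    rw [pow_add, mul_comm (2 ^ n), Nat.mul_min_mul_left]
  rw [this]
  push_cast
  rw [pow_add]
  field_simp

/-- The index of the interval of the `n`-th subdivision of `[0, u]` containing `t`. -/
noncomputable def cell (n : ℕ) (t : TimeInterval T) : ℕ := ⌈t.1 / u.1 * 2 ^ n⌉₊ - 1

variable {u} {n : ℕ} {t : TimeInterval T}

lemma cell_spec (ht : ⊥ < t) (htu : t ≤ u) :
    cell u n t < 2 ^ n ∧ grid u n (cell u n t) < t ∧ t ≤ grid u n (cell u n t + 1) := by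
  have ht' : 0 < t.1 := ht
  have htu' : t.1 ≤ u.1 := htu
  have hu : 0 < u.1 := ht'.trans_le htu'
  have hpos : 0 < t.1 / u.1 * 2 ^ n := by positivity
  have h1 : 0 < ⌈t.1 / u.1 * 2 ^ n⌉₊ := Nat.ceil_pos.2 hpos
  have h2 : ⌈t.1 / u.1 * 2 ^ n⌉₊ ≤ 2 ^ n := by
    rw [Nat.ceil_le]
    push_cast
    have : t.1 / u.1 ≤ 1 := div_le_one_of_le₀ htu' hu.le
    simpa using mul_le_mul_left this (2 ^ n)
  have hc : cell u n t + 1 = ⌈t.1 / u.1 * 2 ^ n⌉₊ := by unfold cell; omega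
  have hlt : cell u n t < 2 ^ n := by omega
  refine ⟨hlt, ?_, ?_⟩
  · change (_ : ℝ≥0) < _
    have : ((cell u n t : ℕ) : ℝ≥0) < t.1 / u.1 * 2 ^ n := by
      rw [← Nat.lt_ceil]; omega
    simp only [grid, min_eq_left hlt.le]
    rw [div_lt_iff₀ (by positivity)]
    calc u.1 * (cell u n t : ℝ≥0) < u.1 * (t.1 / u.1 * 2 ^ n) := by gcongr
      _ = t.1 * 2 ^ n := by field_simp
  · change (_ : ℝ≥0) ≤ _
    have : t.1 / u.1 * 2 ^ n ≤ ((cell u n t + 1 : ℕ) : ℝ≥0) := by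
      rw [hc]; exact Nat.le_ceil _
    have h3 : min (cell u n t + 1) (2 ^ n) = cell u n t + 1 := min_eq_left hlt
    simp only [grid, h3]
    rw [le_div_iff₀ (by positivity)]
    calc t.1 * 2 ^ n = u.1 * (t.1 / u.1 * 2 ^ n) := by field_simp
      _ ≤ _ := by gcongr

lemma grid_succ_le (i : ℕ) : (grid u n (i + 1)).1 ≤ (grid u n i).1 + u.1 / 2 ^ n := by
  simp only [grid]
  rw [← add_div]
  gcongr
  calc u.1 * ((min (i + 1) (2 ^ n) : ℕ) : ℝ≥0) ≤ u.1 * ((min i (2 ^ n) + 1 : ℕ) : ℝ≥0) := by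
        gcongr
        omega
    _ = _ := by push_cast; ring

lemma tendsto_mesh : Tendsto (fun n : ℕ => u.1 / 2 ^ n) atTop (𝓝 0) := by
  have : Tendsto (fun n : ℕ => u.1 * (2⁻¹ : ℝ≥0) ^ n) atTop (𝓝 (u.1 * 0)) :=
    (tendsto_pow_atTop_nhds_zero_of_lt_one (by simp)
      (by rw [← NNReal.coe_lt_coe]; push_cast; norm_num)).const_mul _
  simpa [div_eq_mul_inv] using this

/-- The approach is strictly from the left, so a path evaluated along it tends to its left limit at
`t`. -/
lemma tendsto_grid_cell (ht : ⊥ < t) (htu : t ≤ u) :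
    Tendsto (fun n => grid u n (cell u n t)) atTop (𝓝[<] t) := by
  refine tendsto_nhdsWithin_iff.2 ⟨?_, .of_forall fun n => (cell_spec ht htu).2.1⟩
  rw [tendsto_subtype_rng]
  refine tendsto_of_tendsto_of_tendsto_of_le_of_le (g := fun n => t.1 - u.1 / 2 ^ n)
    (h := fun _ => t.1) ?_ tendsto_const_nhds (fun n => ?_) (fun n => ?_)
  · simpa using (tendsto_const_nhds (x := t.1)).sub (tendsto_mesh (u := u))
  · rw [tsub_le_iff_right]
    exact le_trans (cell_spec ht htu).2.2 (grid_succ_le _)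
  · exact (cell_spec ht htu).2.1.le

lemma tendsto_grid_cell_succ (ht : ⊥ < t) (htu : t ≤ u) :
    Tendsto (fun n => grid u n (cell u n t + 1)) atTop (𝓝[≥] t) := by
  refine tendsto_nhdsWithin_iff.2 ⟨?_, .of_forall fun n => (cell_spec ht htu).2.2⟩
  rw [tendsto_subtype_rng]
  refine tendsto_of_tendsto_of_tendsto_of_le_of_le (g := fun _ => t.1)
    (h := fun n => t.1 + u.1 / 2 ^ n) tendsto_const_nhds ?_ (fun n => ?_) (fun n => ?_)
  · simpa using (tendsto_const_nhds (x := t.1)).add (tendsto_mesh (u := u))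
  · exact (cell_spec ht htu).2.2
  · exact le_trans (grid_succ_le _) (add_le_add
      (show (grid u n _).1 ≤ t.1 from (cell_spec ht htu).2.1.le) le_rfl)

lemma exists_grid_mem_Ioo {s t : TimeInterval T} (h : s < t) :
    ∃ n i, s < grid ⊤ n i ∧ grid ⊤ n i < t := by
  have := tendsto_grid_cell (u := ⊤) (bot_le.trans_lt h) le_top
  obtain ⟨n, hn⟩ := (this.eventually (Ioo_mem_nhdsLT h)).exists
  exact ⟨n, _, hn⟩

lemma exists_grid_seq_gt {s : TimeInterval T} (h : s < ⊤) :
    ∃ q : ℕ → ℕ × ℕ, (∀ k, s < grid ⊤ (q k).1 (q k).2) ∧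
      Tendsto (fun k => grid (⊤ : TimeInterval T) (q k).1 (q k).2) atTop (𝓝[>] s) := by
  obtain ⟨v, -, hv, hvt⟩ := exists_seq_strictAnti_tendsto' h
  choose n i h1 h2 using fun k => exists_grid_mem_Ioo (hv k).1
  refine ⟨fun k => (n k, i k), h1, tendsto_nhdsWithin_iff.2 ⟨?_, .of_forall h1⟩⟩
  exact tendsto_of_tendsto_of_tendsto_of_le_of_le tendsto_const_nhds hvt
    (fun k => (h1 k).le) (fun k => (h2 k).le)

lemma sum_indicator_grid (c : ℕ → ℝ) (ht : ⊥ < t) (htu : t ≤ u) :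
    ∑ i ∈ Finset.range (2 ^ n), (Set.Ioc (grid u n i) (grid u n (i + 1))).indicator
      (fun _ => c i) t = c (cell u n t) := by
  obtain ⟨h1, h2, h3⟩ := cell_spec (n := n) ht htu
  rw [Finset.sum_eq_single_of_mem (cell u n t) (Finset.mem_range.2 h1)]
  · exact Set.indicator_of_mem (show t ∈ Set.Ioc _ _ from ⟨h2, h3⟩) _
  · intro j _ hj
    apply Set.indicator_of_notMem
    rintro ⟨h4, h5⟩
    rcases lt_or_gt_of_ne hj with hlt | hlt
    · exact absurd (h5.trans (grid_mono u n hlt)) (not_le.2 h2)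
    · exact absurd (h3.trans (grid_mono u n hlt)) (not_le.2 h4)

lemma sum_indicator_grid_of_notMem (c : ℕ → ℝ) (ht : t ∉ Set.Ioc ⊥ u) :
    ∑ i ∈ Finset.range (2 ^ n), (Set.Ioc (grid u n i) (grid u n (i + 1))).indicator
      (fun _ => c i) t = 0 := by
  refine Finset.sum_eq_zero fun i _ => Set.indicator_of_notMem (fun h => ht ?_) _
  exact ⟨bot_le.trans_lt h.1, h.2.trans (grid_le u _ _)⟩

end Grid

/-! ### Increasing processes, their path measures and their Doléans measures. -/

/-- A measurable process, not assumed adapted to any filtration, with nondecreasing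
right-continuous paths starting at `0`. -/
structure IsIncreasingProcess {T : ℝ≥0} {Ω : Type*} [MeasurableSpace Ω]
    (V : TimeInterval T → Ω → ℝ) : Prop where
  mono : ∀ ω, Monotone fun t => V t ω
  rightCont : ∀ ω t, ContinuousWithinAt (fun t => V t ω) (Set.Ici t) t
  bot : ∀ ω, V ⊥ ω = 0
  meas : ∀ t, Measurable (V t)

namespace IsIncreasingProcess

variable {T : ℝ≥0} {Ω : Type*} {m : MeasurableSpace Ω} {V W : TimeInterval T → Ω → ℝ}

lemma nonneg (hV : IsIncreasingProcess V) (t : TimeInterval T) (ω : Ω) : 0 ≤ V t ω :=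
  (hV.bot ω).symm.le.trans (hV.mono ω bot_le)

lemma le_top (hV : IsIncreasingProcess V) (t : TimeInterval T) (ω : Ω) : V t ω ≤ V ⊤ ω :=
  hV.mono ω _root_.le_top

protected lemma add (hV : IsIncreasingProcess V) (hW : IsIncreasingProcess W) :
    IsIncreasingProcess fun t ω => V t ω + W t ω where
  mono ω := (hV.mono ω).add (hW.mono ω)
  rightCont ω t := (hV.rightCont ω t).add (hW.rightCont ω t)
  bot ω := by simp [hV.bot, hW.bot]
  meas t := (hV.meas t).add (hW.meas t)

/-- The Stieltjes measure of a path. -/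
noncomputable def pathMeasure (hV : IsIncreasingProcess V) (ω : Ω) : Measure (TimeInterval T) :=
  (StieltjesFunction.mk (fun t => V t ω) (hV.mono ω) (hV.rightCont ω)).measure

lemma pathMeasure_Ioc (hV : IsIncreasingProcess V) (ω : Ω) (s t : TimeInterval T) :
    hV.pathMeasure ω (Set.Ioc s t) = ENNReal.ofReal (V t ω - V s ω) := by
  simp [pathMeasure]

lemma pathMeasure_Ioi (hV : IsIncreasingProcess V) (ω : Ω) (s : TimeInterval T) :
    hV.pathMeasure ω (Set.Ioi s) = ENNReal.ofReal (V ⊤ ω - V s ω) := by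
  rw [← hV.pathMeasure_Ioc]
  congr 1
  ext t
  simp

lemma pathMeasure_bot (hV : IsIncreasingProcess V) (ω : Ω) :
    hV.pathMeasure ω {⊥} = 0 := by
  rw [← botSet_eq_singleton_of_isBot isBot_bot]
  simp [pathMeasure]

lemma pathMeasure_univ (hV : IsIncreasingProcess V) (ω : Ω) :
    hV.pathMeasure ω Set.univ = ENNReal.ofReal (V ⊤ ω) := by
  have : (Set.univ : Set (TimeInterval T)) = {⊥} ∪ Set.Ioi ⊥ := by
    ext t
    simp
  rw [this, measure_union (by simp) measurableSet_Ioi, hV.pathMeasure_bot, hV.pathMeasure_Ioi,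
    hV.bot]
  simp

instance (hV : IsIncreasingProcess V) (ω : Ω) : IsFiniteMeasure (hV.pathMeasure ω) :=
  ⟨by simp [hV.pathMeasure_univ]⟩

lemma pathMeasure_real_Ioc (hV : IsIncreasingProcess V) (ω : Ω) {s t : TimeInterval T}
    (h : s ≤ t) : (hV.pathMeasure ω).real (Set.Ioc s t) = V t ω - V s ω := by
  rw [measureReal_def, pathMeasure_Ioc, ENNReal.toReal_ofReal (sub_nonneg.2 (hV.mono ω h))]

lemma ioc_piSystem : IsPiSystem {S : Set (TimeInterval T) | ∃ l u, l ≤ u ∧ Set.Ioc l u = S} := by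
  rintro _ ⟨a, b, -, rfl⟩ _ ⟨c, d, -, rfl⟩ h
  rw [Set.Ioc_inter_Ioc] at h ⊢
  exact ⟨_, _, (Set.nonempty_Ioc.1 h).le, rfl⟩

lemma generateFrom_ioc : (inferInstance : MeasurableSpace (TimeInterval T)) =
    MeasurableSpace.generateFrom {S | ∃ l u, l ≤ u ∧ Set.Ioc l u = S} := by
  rw [← borel_eq_generateFrom_Ioc_le]
  exact BorelSpace.measurable_eq

lemma pathMeasure_add (hV : IsIncreasingProcess V) (hW : IsIncreasingProcess W) (ω : Ω) :
    (hV.add hW).pathMeasure ω = hV.pathMeasure ω + hW.pathMeasure ω := by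
  refine ext_of_generate_finite _ generateFrom_ioc ioc_piSystem ?_ ?_
  · rintro _ ⟨s, t, hst, rfl⟩
    rw [Measure.add_apply]
    simp only [pathMeasure_Ioc]
    rw [← ENNReal.ofReal_add (sub_nonneg.2 (hV.mono ω hst)) (sub_nonneg.2 (hW.mono ω hst))]
    congr 1
    ring
  · rw [Measure.add_apply]
    simp only [pathMeasure_univ]
    rw [← ENNReal.ofReal_add (hV.nonneg _ _) (hW.nonneg _ _)]

lemma measurable_pathMeasure (hV : IsIncreasingProcess V) : Measurable hV.pathMeasure := by
  refine Measurable.measure_of_isPiSystem generateFrom_ioc ioc_piSystem ?_ ?_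
  · rintro _ ⟨s, t, -, rfl⟩
    simp only [pathMeasure_Ioc]
    exact ((hV.meas t).sub (hV.meas s)).ennreal_ofReal
  · simp only [pathMeasure_univ]
    exact (hV.meas ⊤).ennreal_ofReal

/-- The path measures, transported to the graph of `t ↦ (t, ω)`. -/
noncomputable def graphKernel (hV : IsIncreasingProcess V) :
    ProbabilityTheory.Kernel Ω (TimeInterval T × Ω) where
  toFun ω := (hV.pathMeasure ω).map fun t => (t, ω)
  measurable' := by
    have (ω : Ω) : IsFiniteMeasure ((hV.pathMeasure ω).map fun t => (t, ω)) := inferInstance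
    refine Measurable.measure_of_isPiSystem generateFrom_prod.symm isPiSystem_prod ?_ ?_
    · rintro _ ⟨s, hs, t, ht, rfl⟩
      have hs' : MeasurableSet s := hs
      have ht' : MeasurableSet t := ht
      have : (fun ω => ((hV.pathMeasure ω).map fun t => (t, ω)) (s ×ˢ t)) =
          t.indicator fun ω => hV.pathMeasure ω s := by
        ext ω
        rw [Measure.map_apply measurable_prodMk_right (hs'.prod ht')]
        by_cases h : ω ∈ t <;> simp [h, Set.preimage]
      rw [this]
      exact ((Measure.measurable_coe hs').comp hV.measurable_pathMeasure).indicator ht'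
    · have : (fun ω => ((hV.pathMeasure ω).map fun t => (t, ω)) Set.univ) =
          fun ω => hV.pathMeasure ω Set.univ := by
        ext ω
        rw [Measure.map_apply measurable_prodMk_right .univ, Set.preimage_univ]
      rw [this]
      exact (Measure.measurable_coe .univ).comp hV.measurable_pathMeasure

/-- The Doléans measure `S ↦ E[∫ 1_S dV]` on `[0, T] × Ω`. -/
noncomputable def doleans (hV : IsIncreasingProcess V) (P : Measure Ω) :
    Measure (TimeInterval T × Ω) :=
  P.bind hV.graphKernel

variable {P : Measure Ω}

lemma lintegral_doleans (hV : IsIncreasingProcess V) {f : TimeInterval T × Ω → ℝ≥0∞}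
    (hf : Measurable f) :
    ∫⁻ x, f x ∂hV.doleans P = ∫⁻ ω, ∫⁻ t, f (t, ω) ∂hV.pathMeasure ω ∂P := by
  rw [doleans, Measure.lintegral_bind hV.graphKernel.measurable.aemeasurable hf.aemeasurable]
  refine lintegral_congr fun ω => ?_
  exact lintegral_map hf measurable_prodMk_right

lemma doleans_Ioi_prod (hV : IsIncreasingProcess V) (s : TimeInterval T) {A : Set Ω}
    (hA : MeasurableSet A) :
    hV.doleans P (Set.Ioi s ×ˢ A) = ∫⁻ ω in A, ENNReal.ofReal (V ⊤ ω - V s ω) ∂P := by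
  rw [← lintegral_indicator_one (measurableSet_Ioi.prod hA),
    hV.lintegral_doleans (measurable_one.indicator (measurableSet_Ioi.prod hA)),
    ← lintegral_indicator hA]
  refine lintegral_congr fun ω => ?_
  simp only [← hV.pathMeasure_Ioi]
  by_cases h : ω ∈ A
  · have : (fun t => (Set.Ioi s ×ˢ A).indicator (1 : TimeInterval T × Ω → ℝ≥0∞) (t, ω)) =
        (Set.Ioi s).indicator 1 := by
      ext t
      simp [Set.indicator, h]
    rw [this, lintegral_indicator_one measurableSet_Ioi]
    simp [h]
  · simp [Set.indicator, h]

lemma doleans_bot_prod (hV : IsIncreasingProcess V) (A : Set Ω) :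
    hV.doleans P ({⊥} ×ˢ A) = 0 := by
  refine measure_mono_null (t := {⊥} ×ˢ Set.univ) (Set.prod_mono subset_rfl (Set.subset_univ _)) ?_
  have hm : MeasurableSet (({⊥} : Set (TimeInterval T)) ×ˢ (Set.univ : Set Ω)) :=
    (measurableSet_singleton _).prod .univ
  rw [← lintegral_indicator_one hm, hV.lintegral_doleans (measurable_one.indicator hm)]
  refine lintegral_eq_zero_of_ae_eq_zero (.of_forall fun ω => ?_)
  have : (fun t => (({⊥} : Set (TimeInterval T)) ×ˢ (Set.univ : Set Ω)).indicator
      (1 : TimeInterval T × Ω → ℝ≥0∞) (t, ω)) = ({⊥} : Set (TimeInterval T)).indicator 1 := by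
    ext t
    simp [Set.indicator]
  beta_reduce
  rw [this, lintegral_indicator_one (measurableSet_singleton _), hV.pathMeasure_bot]
  rfl

lemma doleans_univ (hV : IsIncreasingProcess V) :
    hV.doleans P Set.univ = ∫⁻ ω, ENNReal.ofReal (V ⊤ ω) ∂P := by
  rw [← lintegral_one, hV.lintegral_doleans measurable_const]
  simp [pathMeasure_univ]

lemma isFiniteMeasure_doleans (hV : IsIncreasingProcess V) (hi : Integrable (V ⊤) P) :
    IsFiniteMeasure (hV.doleans P) :=
  ⟨by rw [doleans_univ]; exact hi.lintegral_lt_top⟩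

lemma integrable_doleans (hV : IsIncreasingProcess V) (hi : Integrable (V ⊤) P)
    {f : TimeInterval T × Ω → ℝ} (hf : StronglyMeasurable f) {C : ℝ} (hC : ∀ x, |f x| ≤ C) :
    Integrable f (hV.doleans P) := by
  have := hV.isFiniteMeasure_doleans hi
  exact Integrable.of_bound hf.aestronglyMeasurable C (.of_forall hC)

/-- In this form the disintegration of Bochner integrals over a composition of kernels applies. -/
lemma doleans_eq_comp (hV : IsIncreasingProcess V) [IsProbabilityMeasure P] : hV.doleans P =
    ProbabilityTheory.Kernel.comp hV.graphKernel (ProbabilityTheory.Kernel.const Unit P) () := by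
  rw [ProbabilityTheory.Kernel.comp_apply]
  rfl

lemma integral_graphKernel (hV : IsIncreasingProcess V)
    {f : TimeInterval T × Ω → ℝ} (hf : StronglyMeasurable f) (ω : Ω) :
    ∫ x, f x ∂hV.graphKernel ω = ∫ t, f (t, ω) ∂hV.pathMeasure ω :=
  integral_map measurable_prodMk_right.aemeasurable hf.aestronglyMeasurable

lemma integral_doleans (hV : IsIncreasingProcess V) [IsProbabilityMeasure P]
    (hi : Integrable (V ⊤) P)
    {f : TimeInterval T × Ω → ℝ} (hf : StronglyMeasurable f) {C : ℝ} (hC : ∀ x, |f x| ≤ C) :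
    ∫ x, f x ∂hV.doleans P = ∫ ω, ∫ t, f (t, ω) ∂hV.pathMeasure ω ∂P := by
  have h := hV.integrable_doleans hi hf hC
  rw [doleans_eq_comp] at h ⊢
  rw [ProbabilityTheory.Kernel.integral_comp h]
  simp only [hV.integral_graphKernel hf, ProbabilityTheory.Kernel.const_apply]

lemma integrable_integral_pathMeasure (hV : IsIncreasingProcess V) [IsProbabilityMeasure P]
    (hi : Integrable (V ⊤) P)
    {f : TimeInterval T × Ω → ℝ} (hf : StronglyMeasurable f) {C : ℝ} (hC : ∀ x, |f x| ≤ C) :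
    Integrable (fun ω => ∫ t, f (t, ω) ∂hV.pathMeasure ω) P := by
  have h := hV.integrable_doleans hi hf hC
  rw [doleans_eq_comp] at h
  have := h.integral_comp
  simpa only [hV.integral_graphKernel hf, ProbabilityTheory.Kernel.const_apply] using this

end IsIncreasingProcess

/-! ### Doléans measures on the predictable σ-algebra. -/

section Predictable

variable {T : ℝ≥0} {Ω : Type*} {m : MeasurableSpace Ω} {P : Measure Ω}
  {V W : TimeInterval T → Ω → ℝ} (𝓗 : Filtration (TimeInterval T) m)

lemma predictable_le : 𝓗.predictable ≤ Prod.instMeasurableSpace := by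
  refine measurableSpace_le_predictable_of_measurableSet (fun A hA => ?_) fun i A hA => ?_
  · exact (measurableSet_singleton _).prod (𝓗.le _ _ hA)
  · exact measurableSet_Ioi.prod (𝓗.le _ _ hA)

lemma _root_.MeasureTheory.IsStronglyPredictable.stronglyMeasurable
    {𝓗 : Filtration (TimeInterval T) m} (h : IsStronglyPredictable 𝓗 V) :
    StronglyMeasurable (Function.uncurry V) :=
  StronglyMeasurable.mono h (predictable_le 𝓗)

/-- Two increasing processes whose increments over `(s, T]` have the same conditional expectation
given `𝓗 s`, for every `s`. -/
def HaveSameProjection (P : Measure Ω) (V W : TimeInterval T → Ω → ℝ) : Prop :=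
  ∀ s A, MeasurableSet[𝓗 s] A →
    ∫⁻ ω in A, ENNReal.ofReal (V ⊤ ω - V s ω) ∂P = ∫⁻ ω in A, ENNReal.ofReal (W ⊤ ω - W s ω) ∂P

variable {𝓗}

/-- The sets `{⊥} ×ˢ A` and `Ioi s ×ˢ A` form a π-system. The former are null for both measures
because path measures do not charge time `0`; on the latter the two measures agree by hypothesis. -/
lemma HaveSameProjection.trim_doleans (hV : IsIncreasingProcess V) (hW : IsIncreasingProcess W)
    (hi : Integrable (V ⊤) P) (h : HaveSameProjection 𝓗 P V W) :
    (hV.doleans P).trim (predictable_le 𝓗) = (hW.doleans P).trim (predictable_le 𝓗) := by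
  have := hV.isFiniteMeasure_doleans hi
  refine @ext_of_generate_finite _ 𝓗.predictable _ _ _ rfl ?_ ?_ ?_ ?_
  · rintro _ (⟨A, hA, rfl⟩ | ⟨i, A, hA, rfl⟩) _ (⟨B, hB, rfl⟩ | ⟨j, B, hB, rfl⟩) hne
    · exact Or.inl ⟨A ∩ B, hA.inter hB, by rw [Set.prod_inter_prod, Set.inter_self]⟩
    · obtain ⟨x, hx⟩ := hne
      simp only [Set.mem_inter_iff, Set.mem_prod, Set.mem_singleton_iff, Set.mem_Ioi] at hx
      exact absurd hx.2.1 (by simp [hx.1.1])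
    · obtain ⟨x, hx⟩ := hne
      simp only [Set.mem_inter_iff, Set.mem_prod, Set.mem_singleton_iff, Set.mem_Ioi] at hx
      exact absurd hx.1.1 (by simp [hx.2.1])
    · refine Or.inr ⟨i ⊔ j, A ∩ B, ?_, by rw [Set.prod_inter_prod, Set.Ioi_inter_Ioi]⟩
      exact (𝓗.mono le_sup_left _ hA).inter (𝓗.mono le_sup_right _ hB)
  · infer_instance
  · rintro s hs
    rw [trim_measurableSet_eq _ (MeasurableSpace.measurableSet_generateFrom hs),
      trim_measurableSet_eq _ (MeasurableSpace.measurableSet_generateFrom hs)]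
    rcases hs with ⟨A, hA, rfl⟩ | ⟨i, A, hA, rfl⟩
    · rw [hV.doleans_bot_prod, hW.doleans_bot_prod]
    · rw [hV.doleans_Ioi_prod _ (𝓗.le _ _ hA), hW.doleans_Ioi_prod _ (𝓗.le _ _ hA), h i A hA]
  · rw [trim_measurableSet_eq _ .univ, trim_measurableSet_eq _ .univ, hV.doleans_univ,
      hW.doleans_univ]
    simpa [hV.bot, hW.bot] using h ⊥ Set.univ .univ

lemma HaveSameProjection.integral_doleans (hV : IsIncreasingProcess V)
    (hW : IsIncreasingProcess W) (hi : Integrable (V ⊤) P) (h : HaveSameProjection 𝓗 P V W)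
    {φ : TimeInterval T → Ω → ℝ} (hφ : IsStronglyPredictable 𝓗 φ) :
    ∫ x, φ x.1 x.2 ∂hV.doleans P = ∫ x, φ x.1 x.2 ∂hW.doleans P := by
  have e1 := integral_trim (predictable_le 𝓗) (μ := hV.doleans P) hφ
  have e2 := integral_trim (predictable_le 𝓗) (μ := hW.doleans P) hφ
  rw [h.trim_doleans hV hW hi] at e1
  exact e1.trans e2.symm

end Predictable

/-! ### Pathwise Stieltjes integrals as differences of integrals against path measures. -/

section Stieltjes

variable {T : ℝ≥0} {Ω : Type*} {m : MeasurableSpace Ω} {p n : TimeInterval T → Ω → ℝ}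

lemma rightLim_eq_of_continuousWithinAt_Ici {g : TimeInterval T → ℝ} {t : TimeInterval T}
    (h : ContinuousWithinAt g (Set.Ici t) t) : Function.rightLim g t = g t := by
  rcases eq_or_neBot (𝓝[>] t) with h' | h'
  · exact rightLim_eq_of_eq_bot _ h'
  · exact rightLim_eq_of_tendsto (h.mono Set.Ioi_subset_Ici_self)

/-- The signed measure of `g` and the difference of the two path measures agree on half-open
intervals and both vanish on `{⊥}`, so they coincide. -/
lemma stieltjesIntegral_eq_sub (hp : IsIncreasingProcess p) (hn : IsIncreasingProcess n)
    {ω : Ω} {g : TimeInterval T → ℝ} (hg : BoundedVariationOn g Set.univ)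
    (h : ∀ t, g t - g ⊥ = p t ω - n t ω)
    {φ : TimeInterval T → ℝ} (hφ : Measurable φ) {C : ℝ} (hC : ∀ t, |φ t| ≤ C) :
    stieltjesIntegral φ g = ∫ t, φ t ∂hp.pathMeasure ω - ∫ t, φ t ∂hn.pathMeasure ω := by
  have hgt (t) : g t = g ⊥ + (p t ω - n t ω) := by rw [← h]; ring
  have hright (t : TimeInterval T) : Function.rightLim g t = g t := by
    refine rightLim_eq_of_continuousWithinAt_Ici ?_
    rw [funext hgt]
    exact continuousWithinAt_const.add ((hp.rightCont ω t).sub (hn.rightCont ω t))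
  have hbot : hg.vectorMeasure {⊥} = 0 := by
    rw [hg.vectorMeasure_singleton, hright, leftLim_eq_of_isBot isBot_bot, sub_self]
  have hIoc {s t : TimeInterval T} (hst : s ≤ t) : hg.vectorMeasure (Set.Ioc s t) =
      ((hp.pathMeasure ω).toSignedMeasure - (hn.pathMeasure ω).toSignedMeasure) (Set.Ioc s t) := by
    rw [hg.vectorMeasure_Ioc hst, hright, hright, sub_apply,
      Measure.toSignedMeasure_apply_measurable measurableSet_Ioc,
      Measure.toSignedMeasure_apply_measurable measurableSet_Ioc,
      hp.pathMeasure_real_Ioc ω hst, hn.pathMeasure_real_Ioc ω hst, hgt t, hgt s]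
    ring
  have key : hg.vectorMeasure =
      (hp.pathMeasure ω).toSignedMeasure - (hn.pathMeasure ω).toSignedMeasure := by
    refine VectorMeasure.ext_of_generateFrom _ ?_ IsIncreasingProcess.generateFrom_ioc
      IsIncreasingProcess.ioc_piSystem ?_
    · rintro _ ⟨s, t, hst, rfl⟩
      exact hIoc hst
    · have : (Set.univ : Set (TimeInterval T)) = {⊥} ∪ Set.Ioc ⊥ ⊤ := by
        ext t
        simp
      rw [this, VectorMeasure.of_union (by simp) (measurableSet_singleton _) measurableSet_Ioc,
        VectorMeasure.of_union (by simp) (measurableSet_singleton _) measurableSet_Ioc,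
        hIoc bot_le, hbot]
      congr 1
      rw [sub_apply,
        Measure.toSignedMeasure_apply_measurable (measurableSet_singleton _),
        Measure.toSignedMeasure_apply_measurable (measurableSet_singleton _)]
      simp [measureReal_def, hp.pathMeasure_bot, hn.pathMeasure_bot]
  have hint (μ : Measure (TimeInterval T)) [IsFiniteMeasure μ] :
      μ.toSignedMeasure.Integrable φ := by
    rw [VectorMeasure.Integrable, Measure.variation_toSignedMeasure]
    exact Integrable.of_bound hφ.aestronglyMeasurable C (.of_forall hC)
  -- Multiplication on `ℝ` is commutative; the flipped pairing is the one for which integrals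
  -- against a measure and its signed measure are identified.
  have hlsmul : ContinuousLinearMap.lsmul ℝ ℝ =
      (ContinuousLinearMap.lsmul ℝ ℝ : ℝ →L[ℝ] ℝ →L[ℝ] ℝ).flip := by
    ext
    simp
  rw [stieltjesIntegral, dif_pos hg, key, VectorMeasure.integral_sub_vectorMeasure (hint _) (hint _),
    hlsmul, VectorMeasure.integral_toSignedMeasure, VectorMeasure.integral_toSignedMeasure]

variable {P : Measure Ω} {X φ : TimeInterval T → Ω → ℝ}

/-- `X - X ⊥` is almost surely the difference of the integrable increasing processes `p`, `n`. -/
structure IsDecomposition (P : Measure Ω) (X p n : TimeInterval T → Ω → ℝ) : Prop where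
  pos : IsIncreasingProcess p
  neg : IsIncreasingProcess n
  integrable_pos : Integrable (p ⊤) P
  integrable_neg : Integrable (n ⊤) P
  sub_eq : ∀ᵐ ω ∂P, ∀ t, X t ω - X ⊥ ω = p t ω - n t ω

lemma eVariationOn_sub_le {p n : TimeInterval T → ℝ} (hp : Monotone p) (hn : Monotone n) :
    eVariationOn (fun t => p t - n t) Set.univ ≤
      ENNReal.ofReal (p ⊤ - p ⊥) + ENNReal.ofReal (n ⊤ - n ⊥) := by
  have hle {f : TimeInterval T → ℝ} (hf : Monotone f) :
      eVariationOn f Set.univ ≤ ENNReal.ofReal (f ⊤ - f ⊥) := by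
    have := (hf.monotoneOn Set.univ).eVariationOn_eq (Set.mem_univ ⊥) (Set.mem_univ ⊤)
    simpa using this.le
  refine le_trans ?_ (add_le_add (hle hp) (hle hn))
  refine iSup_le fun q => ?_
  refine le_trans ?_ (add_le_add (eVariationOn.sum_le (n := q.1) q.2.2.1 q.2.2.2)
    (eVariationOn.sum_le (n := q.1) q.2.2.1 q.2.2.2))
  rw [← Finset.sum_add_distrib]
  refine Finset.sum_le_sum fun i _ => ?_
  simp only [edist_eq_enorm_sub]
  rw [sub_sub_sub_comm]
  exact enorm_sub_le

lemma IsDecomposition.boundedVariationOn (h : IsDecomposition P X p n) :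
    ∀ᵐ ω ∂P, BoundedVariationOn (fun t => X t ω) Set.univ := by
  filter_upwards [h.sub_eq] with ω hω
  have e : eVariationOn (fun t => X t ω) Set.univ =
      eVariationOn (fun t => p t ω - n t ω) Set.univ := by
    simp only [eVariationOn, ← hω, edist_sub_right]
  rw [BoundedVariationOn, e]
  refine ((eVariationOn_sub_le (h.pos.mono ω) (h.neg.mono ω)).trans_lt ?_).ne
  simp

lemma IsDecomposition.integral_stieltjesIntegral [IsProbabilityMeasure P]
    (h : IsDecomposition P X p n)
    (hφ : StronglyMeasurable (Function.uncurry φ)) {C : ℝ} (hC : ∀ t ω, |φ t ω| ≤ C) :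
    ∫ ω, stieltjesIntegral (fun t => φ t ω) (fun t => X t ω) ∂P =
      ∫ x, φ x.1 x.2 ∂h.pos.doleans P - ∫ x, φ x.1 x.2 ∂h.neg.doleans P := by
  have hC' (x : TimeInterval T × Ω) : |Function.uncurry φ x| ≤ C := hC _ _
  change _ = ∫ x, Function.uncurry φ x ∂_ - ∫ x, Function.uncurry φ x ∂_
  rw [h.pos.integral_doleans h.integrable_pos hφ hC', h.neg.integral_doleans h.integrable_neg hφ hC',
    ← integral_sub (h.pos.integrable_integral_pathMeasure h.integrable_pos hφ hC')
      (h.neg.integrable_integral_pathMeasure h.integrable_neg hφ hC')]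
  refine integral_congr_ae ?_
  filter_upwards [h.sub_eq, h.boundedVariationOn] with ω hω hbv
  exact stieltjesIntegral_eq_sub h.pos h.neg hbv hω
    (hφ.measurable.comp measurable_prodMk_right) fun t => hC t ω

end Stieltjes

/-! ### Measurability of the variation and the Jordan decomposition. -/

section Decomposition

variable {T : ℝ≥0} {Ω : Type*} {m : MeasurableSpace Ω}

lemma monotone_ceil_index (u : TimeInterval T) (k : ℕ) :
    Monotone fun t : TimeInterval T => ⌈t.1 / u.1 * 2 ^ k⌉₊ := by
  intro s t hst
  have : s.1 ≤ t.1 := hst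
  dsimp only
  gcongr

lemma tendsto_grid_ceil {u t : TimeInterval T} (htu : t ≤ u) :
    Tendsto (fun k => grid u k ⌈t.1 / u.1 * 2 ^ k⌉₊) atTop (𝓝[≥] t) := by
  rcases eq_or_lt_of_le (bot_le (a := t)) with h | h
  · subst h
    have (k : ℕ) : grid u k ⌈(⊥ : TimeInterval T).1 / u.1 * 2 ^ k⌉₊ = ⊥ := by
      rw [bot_val]
      simp
    simp only [this]
    exact tendsto_const_pure.mono_right (pure_le_nhdsWithin Set.self_mem_Ici)
  · refine (tendsto_grid_cell_succ h htu).congr fun k => ?_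
    congr 1
    have ht' : 0 < t.1 := h
    have hu : 0 < u.1 := ht'.trans_le htu
    have h1 : 0 < ⌈t.1 / u.1 * 2 ^ k⌉₊ := Nat.ceil_pos.2 (by positivity)
    unfold cell
    omega

/-- Rounding `t` up to the grid is monotone, so the rounded path has variation at most the grid sum.
By right-continuity the rounded paths converge pointwise to `g`, and variation is lower
semicontinuous. The countable supremum is what makes the variation measurable in `ω`. -/
lemma eVariationOn_eq_iSup_grid {g : TimeInterval T → ℝ}
    (hg : ∀ t, ContinuousWithinAt g (Set.Ici t) t) (u : TimeInterval T) :
    eVariationOn g (Set.Iic u) = ⨆ k : ℕ, ∑ i ∈ Finset.range (2 ^ k),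
      edist (g (grid u k (i + 1))) (g (grid u k i)) := by
  refine le_antisymm ?_ (iSup_le fun k => eVariationOn.sum_le (grid_mono u k) (grid_le u k))
  refine le_of_forall_lt fun v hv => ?_
  have hlim : ∀ t ∈ Set.Iic u,
      Tendsto (fun k => g (grid u k ⌈t.1 / u.1 * 2 ^ k⌉₊)) atTop (𝓝 (g t)) :=
    fun t ht => (hg t).tendsto.comp (tendsto_grid_ceil ht)
  obtain ⟨k, hk⟩ := (eVariationOn.lowerSemicontinuous_aux hlim hv).exists
  refine hk.trans_le (le_trans ?_ (le_iSup _ k))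
  have hmono : Monotone fun t : TimeInterval T => grid u k ⌈t.1 / u.1 * 2 ^ k⌉₊ :=
    (grid_mono u k).comp (monotone_ceil_index u k)
  have := eVariationOn.comp_le_of_monotoneOn g (t := Set.Iic u)
    (s := grid u k '' Set.Iic (2 ^ k)) _ (hmono.monotoneOn _) fun t _ => by
      rcases le_total ⌈t.1 / u.1 * 2 ^ k⌉₊ (2 ^ k) with h | h
      · exact ⟨_, h, rfl⟩
      · exact ⟨2 ^ k, Set.self_mem_Iic, by rw [grid_of_le u le_rfl, grid_of_le u h]⟩
  refine this.trans_eq ?_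
  rw [eVariationOn.image_range_of_monotone g (grid_mono u k)]
  exact Finset.sum_congr rfl fun i _ => edist_comm _ _

variable {X : TimeInterval T → Ω → ℝ}

lemma measurable_eVariationOn (hX : ∀ t, Measurable (X t))
    (hc : ∀ ω t, ContinuousWithinAt (fun s => X s ω) (Set.Ici t) t) (u : TimeInterval T) :
    Measurable fun ω => eVariationOn (fun t => X t ω) (Set.Iic u) := by
  simp only [fun ω => eVariationOn_eq_iSup_grid (hc ω) u]
  refine Measurable.iSup fun k => Finset.measurable_sum _ fun i _ => ?_
  exact (hX _).edist (hX _)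

lemma exists_isDecomposition {P : Measure Ω} (hX : ∀ t, Measurable (X t))
    (hc : ∀ ω t, ContinuousWithinAt (fun s => X s ω) (Set.Ici t) t)
    (hi : HasIntegrableVariation P X) : ∃ p n, IsDecomposition P X p n := by
  classical
  have htop : Set.Iic (⊤ : TimeInterval T) = Set.univ := Set.Iic_top
  have hmeas := measurable_eVariationOn hX hc
  set S : Set Ω := {ω | eVariationOn (fun t => X t ω) Set.univ ≠ ∞} with hSdef
  have hS : MeasurableSet S := by
    have := hmeas ⊤
    rw [htop] at this
    exact (this (measurableSet_singleton ∞)).compl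
  have hSae : ∀ᵐ ω ∂P, ω ∈ S := by
    have h1 := hmeas ⊤
    rw [htop] at h1
    filter_upwards [ae_lt_top h1 hi.ne] with ω hω using hω.ne
  let v : TimeInterval T → Ω → ℝ := fun t ω => variationOnFromTo (fun s => X s ω) Set.univ ⊥ t
  have hv_eq (t : TimeInterval T) (ω : Ω) :
      v t ω = (eVariationOn (fun t => X t ω) (Set.Iic t)).toReal := by
    simp [v, variationOnFromTo.eq_of_le _ _ (bot_le : ⊥ ≤ t)]
  have hvm (t : TimeInterval T) : Measurable (v t) := by
    rw [funext (hv_eq t)]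
    exact (hmeas t).ennreal_toReal
  have hvt : Integrable (v ⊤) P := by
    rw [funext (hv_eq ⊤)]
    refine integrable_toReal_of_lintegral_ne_top (hmeas ⊤).aemeasurable ?_
    rw [htop]
    exact hi.ne
  have hbv {ω} (hω : ω ∈ S) : BoundedVariationOn (fun t => X t ω) Set.univ := hω
  -- Both processes are set to zero off `S`, so that every path is increasing and right-continuous;
  -- only the identity with `X` is then almost sure.
  let p : TimeInterval T → Ω → ℝ := fun t => S.indicator (v t)
  let n : TimeInterval T → Ω → ℝ := fun t => S.indicator fun ω => v t ω - (X t ω - X ⊥ ω)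
  have hvbot (ω : Ω) : v ⊥ ω = 0 := variationOnFromTo.self _ _ _
  have hp : IsIncreasingProcess p := by
    refine ⟨fun ω => ?_, fun ω t => ?_, fun ω => ?_, fun t => (hvm t).indicator hS⟩
    · by_cases h : ω ∈ S
      · simp only [p, Set.indicator_of_mem h]
        exact monotoneOn_univ.1 (variationOnFromTo.monotoneOn
          (hbv h).locallyBoundedVariationOn (Set.mem_univ _))
      · simp only [p, Set.indicator_of_notMem h]
        exact monotone_const
    · by_cases h : ω ∈ S
      · simp only [p, Set.indicator_of_mem h]
        exact (hbv h).continuousWithinAt_variationOnFromTo_Ici (hc ω t)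
      · simp only [p, Set.indicator_of_notMem h]
        exact continuousWithinAt_const
    · simp [p, hvbot]
  have hn : IsIncreasingProcess n := by
    refine ⟨fun ω => ?_, fun ω t => ?_, fun ω => ?_,
      fun t => ((hvm t).sub ((hX t).sub (hX ⊥))).indicator hS⟩
    · by_cases h : ω ∈ S
      · simp only [n, Set.indicator_of_mem h]
        have := monotoneOn_univ.1 (variationOnFromTo.sub_self_monotoneOn
          (hbv h).locallyBoundedVariationOn (Set.mem_univ ⊥))
        intro s t hst
        have := this hst
        simp only [Pi.sub_apply] at this
        simp only [v]
        linarith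
      · simp only [n, Set.indicator_of_notMem h]
        exact monotone_const
    · by_cases h : ω ∈ S
      · simp only [n, Set.indicator_of_mem h]
        exact ((hbv h).continuousWithinAt_variationOnFromTo_Ici (hc ω t)).sub
          ((hc ω t).sub continuousWithinAt_const)
      · simp only [n, Set.indicator_of_notMem h]
        exact continuousWithinAt_const
    · simp [n, hvbot]
  refine ⟨p, n, hp, hn, hvt.indicator hS, ?_, ?_⟩
  · refine (hvt.add hvt).mono' (hn.meas ⊤).aestronglyMeasurable ?_
    filter_upwards [hSae] with ω hω
    rw [Real.norm_of_nonneg (hn.nonneg _ _)]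
    simp only [n, Set.indicator_of_mem hω, Pi.add_apply]
    -- This bounds the second process by twice the variation, hence its integrability.
    have : |X ⊤ ω - X ⊥ ω| ≤ v ⊤ ω := by
      rw [hv_eq, htop]
      have := (hbv hω).dist_le (Set.mem_univ ⊤) (Set.mem_univ ⊥)
      rwa [Real.dist_eq] at this
    linarith [neg_abs_le (X ⊤ ω - X ⊥ ω)]
  · filter_upwards [hSae] with ω hω t
    simp only [p, n, Set.indicator_of_mem hω]
    ring

end Decomposition

/-! ### Uniqueness. -/

section Uniqueness

variable {T : ℝ≥0} {Ω : Type*} {m : MeasurableSpace Ω} {𝓗 : Filtration (TimeInterval T) m}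

lemma isStronglyPredictable_iff {u : TimeInterval T → Ω → ℝ} :
    IsStronglyPredictable 𝓗 u ↔ Measurable[𝓗.predictable] (Function.uncurry u) :=
  @stronglyMeasurable_iff_measurable _ _ _ 𝓗.predictable _ _ _ _ _

lemma isStronglyPredictable_const {f : Ω → ℝ} (hf : Measurable[𝓗 ⊥] f) :
    IsStronglyPredictable 𝓗 fun _ => f := by
  rw [isStronglyPredictable_iff]
  intro B hB
  have : Function.uncurry (fun _ : TimeInterval T => f) ⁻¹' B =
      {⊥} ×ˢ (f ⁻¹' B) ∪ Set.Ioi ⊥ ×ˢ (f ⁻¹' B) := by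
    ext ⟨t, ω⟩
    simp only [Set.mem_preimage, Function.uncurry_apply_pair, Set.mem_union, Set.mem_prod,
      Set.mem_singleton_iff, Set.mem_Ioi, bot_lt_iff_ne_bot]
    tauto
  rw [this]
  exact (measurableSet_predictable_singleton_bot_prod (hf hB)).union
    (measurableSet_predictable_Ioi_prod (hf hB))

lemma isStronglyPredictable_indicator_Ioi {s : TimeInterval T} {f : Ω → ℝ}
    (hf : Measurable[𝓗 s] f) :
    IsStronglyPredictable 𝓗 fun t ω => (Set.Ioi s).indicator (fun _ => f ω) t := by
  classical
  rw [isStronglyPredictable_iff]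
  intro B hB
  have : Function.uncurry (fun t ω => (Set.Ioi s).indicator (fun _ => f ω) t) ⁻¹' B =
      Set.Ioi s ×ˢ (f ⁻¹' B) ∪ ((Set.Ioi s ×ˢ Set.univ)ᶜ ∩ {_x | (0 : ℝ) ∈ B}) := by
    ext ⟨t, ω⟩
    by_cases h : s < t <;> simp [Set.indicator, h]
  rw [this]
  refine (measurableSet_predictable_Ioi_prod (hf hB)).union (MeasurableSet.inter ?_ ?_)
  · exact (measurableSet_predictable_Ioi_prod .univ).compl
  · exact @MeasurableSet.const _ 𝓗.predictable _

lemma isStronglyPredictable_indicator_Ioc {s t : TimeInterval T} {f : Ω → ℝ} (hst : s ≤ t)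
    (hf : Measurable[𝓗 s] f) :
    IsStronglyPredictable 𝓗 fun r ω => (Set.Ioc s t).indicator (fun _ => f ω) r := by
  have h1 := isStronglyPredictable_iff.1 (isStronglyPredictable_indicator_Ioi hf)
  have h2 := isStronglyPredictable_iff.1
    (isStronglyPredictable_indicator_Ioi (hf.mono (𝓗.mono hst) le_rfl))
  rw [isStronglyPredictable_iff]
  convert h1.sub h2 using 1
  ext ⟨r, ω⟩
  simp only [Function.uncurry_apply_pair, Pi.sub_apply, Set.indicator, Set.mem_Ioc, Set.mem_Ioi]
  by_cases h3 : t < r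
  · simp [h3, hst.trans_lt h3, h3.not_ge]
  · simp [h3, not_lt.1 h3]

/-- The difference quotient of `x ↦ √(1 + x ^ 2)`. -/
noncomputable def slopeSqrt (x y : ℝ) : ℝ := (x + y) / (√(1 + x ^ 2) + √(1 + y ^ 2))

lemma slopeSqrt_mul (x y : ℝ) : slopeSqrt x y * (y - x) = √(1 + y ^ 2) - √(1 + x ^ 2) := by
  have hx : 0 < √(1 + x ^ 2) := Real.sqrt_pos.2 (by positivity)
  have hy : 0 < √(1 + y ^ 2) := Real.sqrt_pos.2 (by positivity)
  have hx2 := Real.sq_sqrt (show 0 ≤ 1 + x ^ 2 by positivity)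
  have hy2 := Real.sq_sqrt (show 0 ≤ 1 + y ^ 2 by positivity)
  rw [slopeSqrt, div_mul_eq_mul_div, div_eq_iff (by positivity)]
  nlinarith

/-- Boundedness is the reason for using `√(1 + x ^ 2)` instead of `x ^ 2`: the difference quotients
are admissible integrands and no square integrability of the process is needed. -/
lemma abs_slopeSqrt_le (x y : ℝ) : |slopeSqrt x y| ≤ 1 := by
  have h (x : ℝ) : |x| ≤ √(1 + x ^ 2) := Real.abs_le_sqrt (by linarith)
  have hx : 0 < √(1 + x ^ 2) := Real.sqrt_pos.2 (by positivity)
  have hy : 0 < √(1 + y ^ 2) := Real.sqrt_pos.2 (by positivity)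
  rw [slopeSqrt, abs_div, abs_of_pos (add_pos hx hy)]
  exact div_le_one_of_le₀ ((abs_add_le x y).trans (add_le_add (h x) (h y))) (by positivity)

lemma continuous_slopeSqrt : Continuous fun p : ℝ × ℝ => slopeSqrt p.1 p.2 := by
  unfold slopeSqrt
  refine Continuous.div (by fun_prop) (by fun_prop) fun p => ?_
  have hx : 0 < √(1 + p.1 ^ 2) := Real.sqrt_pos.2 (by positivity)
  positivity

variable {P : Measure Ω} {N a b : TimeInterval T → Ω → ℝ}

/-- A predictable process of integrable variation against which all bounded predictable processes
have expected integral zero is constant at each time. -/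
lemma ae_eq_zero_of_integral_doleans_eq [IsProbabilityMeasure P]
    (hN : IsStronglyPredictable 𝓗 N)
    (hcad : ∀ ω, IsCadlag fun t => N t ω) (hbot : ∀ ω, N ⊥ ω = 0) (hd : IsDecomposition P N a b)
    (h : ∀ φ : TimeInterval T → Ω → ℝ, IsStronglyPredictable 𝓗 φ → (∀ t ω, |φ t ω| ≤ 1) →
      ∫ x, φ x.1 x.2 ∂hd.pos.doleans P = ∫ x, φ x.1 x.2 ∂hd.neg.doleans P)
    (t : TimeInterval T) : ∀ᵐ ω ∂P, N t ω = 0 := by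
  have hadapt (s : TimeInterval T) : Measurable[𝓗 s] (N s) := (hN.stronglyAdapted s).measurable
  have hNm (s : TimeInterval T) : Measurable (N s) := (hadapt s).mono (𝓗.le s) le_rfl
  -- `L k` samples `N` at the left end of the current cell, so `ψ k` is predictable, as it uses only
  -- `L k` and `N` itself. In contrast `φ k` looks ahead to the right end of the cell; it is merely
  -- measurable, but its integral telescopes.
  let L (k : ℕ) (s : TimeInterval T) (ω : Ω) : ℝ := ∑ i ∈ Finset.range (2 ^ k),
    (Set.Ioc (grid t k i) (grid t k (i + 1))).indicator (fun _ => N (grid t k i) ω) s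
  let ψ (k : ℕ) (s : TimeInterval T) (ω : Ω) : ℝ :=
    (Set.Ioc ⊥ t).indicator (fun _ => slopeSqrt (L k s ω) (N s ω)) s
  let φ (k : ℕ) (s : TimeInterval T) (ω : Ω) : ℝ := ∑ i ∈ Finset.range (2 ^ k),
    (Set.Ioc (grid t k i) (grid t k (i + 1))).indicator
      (fun _ => slopeSqrt (N (grid t k i) ω) (N (grid t k (i + 1)) ω)) s
  have hL (k) : Measurable[𝓗.predictable] (Function.uncurry (L k)) := by
    have (i : ℕ) := isStronglyPredictable_iff.1 <| isStronglyPredictable_indicator_Ioc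
      (grid_mono t k (Nat.le_succ i)) (hadapt (grid t k i))
    convert Finset.measurable_sum (Finset.range (2 ^ k)) fun i _ => this i using 1
    ext ⟨s, ω⟩
    simp [L]
  have hψ (k) : IsStronglyPredictable 𝓗 (ψ k) := by
    rw [isStronglyPredictable_iff]
    have h1 := continuous_slopeSqrt.measurable.comp
      ((hL k).prodMk (isStronglyPredictable_iff.1 hN))
    have h2 : MeasurableSet[𝓗.predictable] (Set.Ioc ⊥ t ×ˢ (Set.univ : Set Ω)) :=
      measurableSet_predictable_Ioc_prod _ _ .univ
    convert h1.indicator h2 using 1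
    ext ⟨s, ω⟩
    simp [ψ, Set.indicator]
  have hψ1 (k s ω) : |ψ k s ω| ≤ 1 := by
    simp only [ψ, Set.indicator]
    split_ifs
    · exact abs_slopeSqrt_le _ _
    · simp
  have hφ_in (k) {s} (hs : s ∈ Set.Ioc ⊥ t) (ω) : φ k s ω =
      slopeSqrt (N (grid t k (cell t k s)) ω) (N (grid t k (cell t k s + 1)) ω) :=
    sum_indicator_grid _ hs.1 hs.2
  have hφ_out (k) {s} (hs : s ∉ Set.Ioc ⊥ t) (ω) : φ k s ω = 0 :=
    sum_indicator_grid_of_notMem _ hs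
  have hφ1 (k s ω) : |φ k s ω| ≤ 1 := by
    by_cases hs : s ∈ Set.Ioc ⊥ t
    · rw [hφ_in k hs]; exact abs_slopeSqrt_le _ _
    · rw [hφ_out k hs]; simp
  have hφm (k) : StronglyMeasurable (Function.uncurry (φ k)) := by
    refine Measurable.stronglyMeasurable ?_
    have (i : ℕ) : Measurable ((Set.Ioc (grid t k i) (grid t k (i + 1)) ×ˢ
        (Set.univ : Set Ω)).indicator fun x : TimeInterval T × Ω =>
          slopeSqrt (N (grid t k i) x.2) (N (grid t k (i + 1)) x.2)) :=
      (continuous_slopeSqrt.measurable.comp (((hNm _).comp measurable_snd).prodMk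
        ((hNm _).comp measurable_snd))).indicator (measurableSet_Ioc.prod .univ)
    convert Finset.measurable_sum (Finset.range (2 ^ k)) fun i _ => this i using 1
    ext ⟨s, ω⟩
    simp [φ, Set.indicator]
  -- On `(0, t]` both integrands tend to the difference quotient between the left limit of `N` at
  -- `s` and `N s`: left ends approach `s` strictly from below, right ends from above.
  have hlim (x : TimeInterval T × Ω) :
      Tendsto (fun k => φ k x.1 x.2 - ψ k x.1 x.2) atTop (𝓝 0) := by
    obtain ⟨s, ω⟩ := x
    by_cases hs : s ∈ Set.Ioc ⊥ t
    · obtain ⟨l, hl⟩ := (hcad ω s).2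
      have h1 := hl.comp (tendsto_grid_cell hs.1 hs.2)
      have h2 := (hcad ω s).1.tendsto.comp (tendsto_grid_cell_succ hs.1 hs.2)
      have h3 := (continuous_slopeSqrt.tendsto (l, N s ω)).comp (h1.prodMk_nhds h2)
      have h4 := (continuous_slopeSqrt.tendsto (l, N s ω)).comp
        (h1.prodMk_nhds (tendsto_const_nhds (x := N s ω)))
      have h5 := h3.sub h4
      rw [sub_self] at h5
      refine h5.congr fun k => ?_
      simp only [hφ_in k hs, ψ, L, Set.indicator_of_mem hs, sum_indicator_grid _ hs.1 hs.2]
      rfl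
    · simp only [hφ_out _ hs, ψ, Set.indicator_of_notMem hs, sub_self]
      exact tendsto_const_nhds
  have hdct {V : TimeInterval T → Ω → ℝ} (hV : IsIncreasingProcess V)
      (hi : Integrable (V ⊤) P) :
      Tendsto (fun k => ∫ x, φ k x.1 x.2 ∂hV.doleans P - ∫ x, ψ k x.1 x.2 ∂hV.doleans P)
        atTop (𝓝 0) := by
    have := hV.isFiniteMeasure_doleans hi
    have hi1 (k) := hV.integrable_doleans hi (hφm k) fun x => hφ1 k x.1 x.2
    have hi2 (k) := hV.integrable_doleans hi (hψ k).stronglyMeasurable fun x => hψ1 k x.1 x.2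
    have e : Tendsto (fun k => ∫ x, (Function.uncurry (φ k) x - Function.uncurry (ψ k) x)
        ∂hV.doleans P) atTop (𝓝 (∫ _, 0 ∂hV.doleans P)) := by
      refine tendsto_integral_of_dominated_convergence (fun _ => 2)
        (fun k => ((hi1 k).sub (hi2 k)).aestronglyMeasurable) (integrable_const _)
        (fun k => .of_forall fun x => ?_) (.of_forall hlim)
      refine (norm_sub_le _ _).trans ?_
      exact (add_le_add (hφ1 k x.1 x.2) (hψ1 k x.1 x.2)).trans (by norm_num)
    simp only [integral_zero] at e
    refine e.congr fun k => ?_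
    rw [integral_sub (hi1 k) (hi2 k)]
    rfl
  have hpath {V : TimeInterval T → Ω → ℝ} (hV : IsIncreasingProcess V) (k ω) :
      ∫ s, φ k s ω ∂hV.pathMeasure ω = ∑ i ∈ Finset.range (2 ^ k),
        slopeSqrt (N (grid t k i) ω) (N (grid t k (i + 1)) ω) *
          (V (grid t k (i + 1)) ω - V (grid t k i) ω) := by
    rw [integral_finsetSum _ fun i _ => (integrable_const _).indicator measurableSet_Ioc]
    refine Finset.sum_congr rfl fun i _ => ?_
    rw [integral_indicator_const _ measurableSet_Ioc,
      hV.pathMeasure_real_Ioc ω (grid_mono t k (Nat.le_succ i)), smul_eq_mul, mul_comm]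
  -- The sum telescopes to a value independent of `k`; taking `k = 0` below also yields the
  -- integrability of `√(1 + N t ω ^ 2) - 1`.
  have hFk (k) : (fun ω => ∫ s, φ k s ω ∂hd.pos.pathMeasure ω -
      ∫ s, φ k s ω ∂hd.neg.pathMeasure ω) =ᵐ[P] fun ω => √(1 + N t ω ^ 2) - 1 := by
    filter_upwards [hd.sub_eq] with ω hω
    simp only [hbot, sub_zero] at hω
    rw [hpath, hpath, ← Finset.sum_sub_distrib]
    have e (i : ℕ) : slopeSqrt (N (grid t k i) ω) (N (grid t k (i + 1)) ω) *
          (a (grid t k (i + 1)) ω - a (grid t k i) ω) -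
        slopeSqrt (N (grid t k i) ω) (N (grid t k (i + 1)) ω) *
          (b (grid t k (i + 1)) ω - b (grid t k i) ω) =
        √(1 + N (grid t k (i + 1)) ω ^ 2) - √(1 + N (grid t k i) ω ^ 2) := by
      rw [← slopeSqrt_mul, hω (grid t k (i + 1)), hω (grid t k i)]
      ring
    simp only [e]
    rw [Finset.sum_range_sub (fun i => √(1 + N (grid t k i) ω ^ 2)), grid_of_le t le_rfl,
      grid_zero, hbot]
    simp
  have hint1 := hd.pos.integrable_integral_pathMeasure hd.integrable_pos (hφm 0)
    fun x => hφ1 0 x.1 x.2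
  have hint2 := hd.neg.integrable_integral_pathMeasure hd.integrable_neg (hφm 0)
    fun x => hφ1 0 x.1 x.2
  have hint : Integrable (fun ω => √(1 + N t ω ^ 2) - 1) P :=
    (hint1.sub hint2).congr (hFk 0)
  have hE (k) : ∫ x, φ k x.1 x.2 ∂hd.pos.doleans P - ∫ x, φ k x.1 x.2 ∂hd.neg.doleans P =
      ∫ ω, (√(1 + N t ω ^ 2) - 1) ∂P := by
    have e1 := hd.pos.integral_doleans hd.integrable_pos (hφm k) fun x => hφ1 k x.1 x.2
    have e2 := hd.neg.integral_doleans hd.integrable_neg (hφm k) fun x => hφ1 k x.1 x.2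
    have i1 := hd.pos.integrable_integral_pathMeasure hd.integrable_pos (hφm k)
      fun x => hφ1 k x.1 x.2
    have i2 := hd.neg.integrable_integral_pathMeasure hd.integrable_neg (hφm k)
      fun x => hφ1 k x.1 x.2
    rw [← integral_congr_ae (hFk k)]
    exact (congrArg₂ _ e1 e2).trans (integral_sub i1 i2).symm
  have hzero : ∫ ω, (√(1 + N t ω ^ 2) - 1) ∂P = 0 := by
    have := (hdct hd.pos hd.integrable_pos).sub (hdct hd.neg hd.integrable_neg)
    rw [sub_zero] at this
    refine tendsto_nhds_unique (tendsto_const_nhds.congr fun k => ?_) this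
    rw [← hE k, h (ψ k) (hψ k) (hψ1 k)]
    ring
  have hnn : 0 ≤ᵐ[P] fun ω => √(1 + N t ω ^ 2) - 1 := .of_forall fun ω =>
    sub_nonneg.2 (Real.one_le_sqrt.2 (by nlinarith [sq_nonneg (N t ω)]))
  filter_upwards [(integral_eq_zero_iff_of_nonneg_ae hnn hint).1 hzero] with ω hω
  have h1 : √(1 + N t ω ^ 2) = 1 := sub_eq_zero.1 hω
  rw [Real.sqrt_eq_one] at h1
  exact pow_eq_zero_iff (two_ne_zero) |>.1 (by linarith)

lemma ae_forall_eq_zero_of_grid (hc : ∀ ω t, ContinuousWithinAt (fun s => N s ω) (Set.Ici t) t)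
    (h : ∀ t, ∀ᵐ ω ∂P, N t ω = 0) : ∀ᵐ ω ∂P, ∀ t, N t ω = 0 := by
  have hq : ∀ᵐ ω ∂P, ∀ q : ℕ × ℕ, N (grid ⊤ q.1 q.2) ω = 0 := ae_all_iff.2 fun q => h _
  filter_upwards [hq, h ⊤] with ω hω hω' t
  rcases eq_or_lt_of_le (le_top (a := t)) with rfl | ht
  · exact hω'
  obtain ⟨q, -, hq⟩ := exists_grid_seq_gt ht
  have h1 := (hc ω t).tendsto.comp (hq.mono_right (nhdsWithin_mono _ Set.Ioi_subset_Ici_self))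
  refine tendsto_nhds_unique h1 (tendsto_const_nhds.congr fun k => ?_)
  exact (hω (q k)).symm

lemma IsCadlag.sub {f g : TimeInterval T → ℝ} (hf : IsCadlag f) (hg : IsCadlag g) :
    IsCadlag fun t => f t - g t := fun t => by
  obtain ⟨l, hl⟩ := (hf t).2
  obtain ⟨l', hl'⟩ := (hg t).2
  exact ⟨(hf t).1.sub (hg t).1, l - l', hl.sub hl'⟩

lemma isCadlag_const (c : ℝ) : IsCadlag fun _ : TimeInterval T => c := fun _ =>
  ⟨continuousWithinAt_const, c, tendsto_const_nhds⟩

lemma IsDecomposition.sub {X Y p n p' n' : TimeInterval T → Ω → ℝ}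
    (hX : IsDecomposition P X p n) (hY : IsDecomposition P Y p' n') :
    IsDecomposition P (fun t ω => X t ω - X ⊥ ω - (Y t ω - Y ⊥ ω))
      (fun t ω => p t ω + n' t ω) (fun t ω => n t ω + p' t ω) where
  pos := hX.pos.add hY.neg
  neg := hX.neg.add hY.pos
  integrable_pos := hX.integrable_pos.add hY.integrable_neg
  integrable_neg := hX.integrable_neg.add hY.integrable_pos
  sub_eq := by
    filter_upwards [hX.sub_eq, hY.sub_eq] with ω h1 h2 t
    rw [h1, h2]
    ring

lemma integral_doleans_add [IsProbabilityMeasure P] {V W : TimeInterval T → Ω → ℝ}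
    (hV : IsIncreasingProcess V)
    (hW : IsIncreasingProcess W) (hVi : Integrable (V ⊤) P) (hWi : Integrable (W ⊤) P)
    {f : TimeInterval T × Ω → ℝ} (hf : StronglyMeasurable f) {C : ℝ} (hC : ∀ x, |f x| ≤ C) :
    ∫ x, f x ∂(hV.add hW).doleans P = ∫ x, f x ∂hV.doleans P + ∫ x, f x ∂hW.doleans P := by
  rw [(hV.add hW).integral_doleans (hVi.add hWi) hf hC, hV.integral_doleans hVi hf hC,
    hW.integral_doleans hWi hf hC, ← integral_add (hV.integrable_integral_pathMeasure hVi hf hC)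
      (hW.integrable_integral_pathMeasure hWi hf hC)]
  refine integral_congr_ae (.of_forall fun ω => ?_)
  have hb (μ : Measure (TimeInterval T)) [IsFiniteMeasure μ] :
      Integrable (fun t => f (t, ω)) μ :=
    Integrable.of_bound (hf.measurable.comp measurable_prodMk_right).aestronglyMeasurable C
      (.of_forall fun t => hC _)
  dsimp only
  rw [IsIncreasingProcess.pathMeasure_add hV hW, integral_add_measure (hb _) (hb _)]

/-- Two predictable processes of integrable variation with the same expected integrals of bounded
predictable processes have indistinguishable increments from time `0`. -/
lemma ae_forall_sub_bot_eq [IsProbabilityMeasure P] {X Y : TimeInterval T → Ω → ℝ}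
    (hX : IsStronglyPredictable 𝓗 X) (hY : IsStronglyPredictable 𝓗 Y)
    (hXc : ∀ ω, IsCadlag fun t => X t ω) (hYc : ∀ ω, IsCadlag fun t => Y t ω)
    (hXi : HasIntegrableVariation P X) (hYi : HasIntegrableVariation P Y)
    (h : ∀ φ : TimeInterval T → Ω → ℝ, IsStronglyPredictable 𝓗 φ → (∀ t ω, |φ t ω| ≤ 1) →
      ∫ ω, stieltjesIntegral (fun t => φ t ω) (fun t => X t ω) ∂P =
        ∫ ω, stieltjesIntegral (fun t => φ t ω) (fun t => Y t ω) ∂P) :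
    ∀ᵐ ω ∂P, ∀ t, X t ω - X ⊥ ω = Y t ω - Y ⊥ ω := by
  have hmeas {Z : TimeInterval T → Ω → ℝ} (hZ : IsStronglyPredictable 𝓗 Z) (t) :
      Measurable (Z t) := (hZ.stronglyAdapted t).measurable.mono (𝓗.le t) le_rfl
  obtain ⟨p, n, hd⟩ := exists_isDecomposition (hmeas hX) (fun ω t => (hXc ω t).1) hXi
  obtain ⟨p', n', hd'⟩ := exists_isDecomposition (hmeas hY) (fun ω t => (hYc ω t).1) hYi
  let N : TimeInterval T → Ω → ℝ := fun t ω => X t ω - X ⊥ ω - (Y t ω - Y ⊥ ω)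
  have hN : IsStronglyPredictable 𝓗 N := by
    have c {Z : TimeInterval T → Ω → ℝ} (hZ : IsStronglyPredictable 𝓗 Z) :=
      isStronglyPredictable_iff.1 (isStronglyPredictable_const (hZ.stronglyAdapted ⊥).measurable)
    exact isStronglyPredictable_iff.2 (((isStronglyPredictable_iff.1 hX).sub (c hX)).sub
      ((isStronglyPredictable_iff.1 hY).sub (c hY)))
  have hNc (ω) : IsCadlag fun t => N t ω :=
    ((hXc ω).sub (isCadlag_const _)).sub ((hYc ω).sub (isCadlag_const _))
  have hN0 (ω) : N ⊥ ω = 0 := by simp [N]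
  have key := ae_forall_eq_zero_of_grid (fun ω t => (hNc ω t).1)
    (ae_eq_zero_of_integral_doleans_eq hN hNc hN0 (hd.sub hd') fun φ hφ hφ1 => by
      have e := h φ hφ hφ1
      have hm := hφ.stronglyMeasurable
      have hb (x : TimeInterval T × Ω) : |Function.uncurry φ x| ≤ 1 := hφ1 _ _
      rw [hd.integral_stieltjesIntegral hm hφ1, hd'.integral_stieltjesIntegral hm hφ1] at e
      have e1 := integral_doleans_add hd.pos hd'.neg hd.integrable_pos hd'.integrable_neg hm hb
      have e2 := integral_doleans_add hd.neg hd'.pos hd.integrable_neg hd'.integrable_pos hm hb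
      refine e1.trans (Eq.trans ?_ e2.symm)
      simp only [Function.uncurry_def]
      linarith)
  filter_upwards [key] with ω hω t
  exact sub_eq_zero.1 (hω t)

end Uniqueness

/-! ### Forward convex combinations in a Hilbert space. -/

section Convex

/-- Every bounded sequence in a Hilbert space has forward convex combinations converging to a
limit. -/
lemma exists_forward_convex_combination {E : Type*} [NormedAddCommGroup E] [InnerProductSpace ℝ E]
    [CompleteSpace E] (f : ℕ → E) {M : ℝ} (hM : ∀ n, ‖f n‖ ≤ M) :
    ∃ y : E, ∀ (n : ℕ) (ε : ℝ), 0 < ε → ∃ w : ℕ →₀ ℝ, (∀ k, 0 ≤ w k) ∧ (∀ k < n, w k = 0) ∧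
      w.sum (fun _ a => a) = 1 ∧ ‖w.sum (fun k a => a • f k) - y‖ < ε := by
  -- `W n` is the set of convex weights supported on indices at least `n`, and `K n` the closed
  -- convex hull of the corresponding tail of the sequence.
  let W (n : ℕ) : Set (ℕ →₀ ℝ) := {w | (∀ k, 0 ≤ w k) ∧ (∀ k < n, w k = 0) ∧
    Finsupp.linearCombination ℝ (fun _ : ℕ => (1 : ℝ)) w = 1}
  have hWconv (n) : Convex ℝ (W n) := by
    rintro v ⟨hv1, hv2, hv3⟩ w ⟨hw1, hw2, hw3⟩ a b ha hb hab
    refine ⟨fun k => ?_, fun k hk => ?_, ?_⟩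
    · simpa using add_nonneg (mul_nonneg ha (hv1 k)) (mul_nonneg hb (hw1 k))
    · simp [hv2 k hk, hw2 k hk]
    · rw [map_add, map_smul, map_smul, hv3, hw3]
      simpa using hab
  have hWanti {n k : ℕ} (h : n ≤ k) : W k ⊆ W n := fun w hw =>
    ⟨hw.1, fun i hi => hw.2.1 i (hi.trans_le h), hw.2.2⟩
  let K (n : ℕ) : Set E := closure (Finsupp.linearCombination ℝ f '' W n)
  have hKconv (n) : Convex ℝ (K n) := ((hWconv n).linear_image _).closure
  have hmem (n) : f n ∈ K n := by
    refine subset_closure ⟨Finsupp.single n 1, ⟨fun k => ?_, fun k hk => ?_, ?_⟩, by simp⟩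
    · rw [Finsupp.single_apply]; split_ifs <;> simp
    · simp [hk.ne']
    · simp
  have hKanti {n k : ℕ} (h : n ≤ k) : K k ⊆ K n := closure_mono (Set.image_mono (hWanti h))
  -- `v n` is the point of least norm in `K n`. As the sets decrease, these norms increase, and they
  -- stay below `M`; the inequality `hdist` then turns convergence of the squared norms into the
  -- Cauchy property. The limit lies in every `K n`.
  choose v hvK hv using fun n => exists_norm_eq_iInf_of_complete_convex ⟨_, hmem n⟩
    isClosed_closure.isComplete (hKconv n) (0 : E)
  have hinner (n) (x) (hx : x ∈ K n) : ‖v n‖ ^ 2 ≤ inner ℝ (v n) x := by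
    have := (norm_eq_iInf_iff_real_inner_le_zero (hKconv n) (hvK n)).1 (hv n) x hx
    rw [zero_sub, inner_neg_left, inner_sub_right, real_inner_self_eq_norm_sq] at this
    linarith
  have hdist {n x} (hx : x ∈ K n) : ‖x - v n‖ ^ 2 ≤ ‖x‖ ^ 2 - ‖v n‖ ^ 2 := by
    rw [norm_sub_sq_real, real_inner_comm]
    linarith [hinner n x hx]
  have hmono : Monotone fun n => ‖v n‖ ^ 2 := fun n k h => by
    have := hdist (hKanti h (hvK k))
    dsimp only
    nlinarith [sq_nonneg ‖v k - v n‖]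
  have hbdd : BddAbove (Set.range fun n => ‖v n‖ ^ 2) := by
    refine ⟨M ^ 2, ?_⟩
    rintro _ ⟨n, rfl⟩
    have := hdist (hmem n)
    have h1 := pow_le_pow_left₀ (norm_nonneg _) (hM n) 2
    dsimp only
    nlinarith [sq_nonneg ‖f n - v n‖]
  have hcauchy : CauchySeq v := by
    have hc := (tendsto_atTop_ciSup hmono hbdd).cauchySeq
    rw [Metric.cauchySeq_iff'] at hc ⊢
    intro ε hε
    obtain ⟨N, hN⟩ := hc (ε ^ 2) (by positivity)
    refine ⟨N, fun n hn => ?_⟩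
    have h1 := hdist (hKanti hn (hvK n))
    have h2 := hN n hn
    rw [Real.dist_eq] at h2
    rw [dist_eq_norm]
    exact lt_of_pow_lt_pow_left₀ 2 hε.le (h1.trans_lt ((le_abs_self _).trans_lt h2))
  obtain ⟨y, hy⟩ := cauchySeq_tendsto_of_complete hcauchy
  refine ⟨y, fun n ε hε => ?_⟩
  have hyK : y ∈ K n := isClosed_closure.mem_of_tendsto hy
    ((eventually_ge_atTop n).mono fun k hk => hKanti hk (hvK k))
  obtain ⟨_, ⟨w, ⟨h1, h2, h3⟩, rfl⟩, hx⟩ := Metric.mem_closure_iff.1 hyK ε hε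
  refine ⟨w, h1, h2, ?_, ?_⟩
  · simpa [Finsupp.linearCombination_apply] using h3
  · rw [dist_comm, dist_eq_norm] at hx
    exact hx

end Convex

/-! ### Discrete compensators along the dyadic grids. -/

section Discrete

variable {T : ℝ≥0} {Ω : Type*} {m : MeasurableSpace Ω} {P : Measure Ω}
  {𝓗 : Filtration (TimeInterval T) m} {V : TimeInterval T → Ω → ℝ}

lemma integral_mul_condExp [IsProbabilityMeasure P] {m' : MeasurableSpace Ω} (hm : m' ≤ m)
    {f X : Ω → ℝ}
    (hf : AEStronglyMeasurable[m'] f P) (hfX : Integrable (f * X) P) (hX : Integrable X P) :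
    ∫ ω, f ω * (P[X | m']) ω ∂P = ∫ ω, f ω * X ω ∂P := by
  rw [← integral_condExp hm (f := fun ω => f ω * X ω)]
  exact integral_congr_ae (condExp_mul_of_aestronglyMeasurable_left hf hfX hX).symm

lemma grid_lt_grid (hT : (⊥ : TimeInterval T) < ⊤) {k i j : ℕ} (hij : i < j) (hi : i < 2 ^ k) :
    grid (⊤ : TimeInterval T) k i < grid ⊤ k j := by
  change (_ : ℝ≥0) < _
  have hT' : 0 < (⊤ : TimeInterval T).1 := hT
  simp only [grid]
  have : min i (2 ^ k) < min j (2 ^ k) := by omega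
  gcongr

variable (𝓗 P V) in
/-- The conditional expectation, given the past, of the increment of `V` over the `i`-th
interval of the `k`-th subdivision. -/
noncomputable def condIncr (k i : ℕ) (ω : Ω) : ℝ :=
  max 0 ((P[fun ω => V (grid ⊤ k (i + 1)) ω - V (grid ⊤ k i) ω | 𝓗 (grid ⊤ k i)]) ω)

variable (𝓗 P V) in
/-- The compensator of `V` along the `k`-th subdivision, extended to a predictable process. -/
noncomputable def discComp (k : ℕ) (t : TimeInterval T) (ω : Ω) : ℝ :=
  ∑ i ∈ Finset.range (2 ^ k),
    (Set.Ioi (grid ⊤ k i)).indicator (fun _ => condIncr P 𝓗 V k i ω) t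

lemma condIncr_nonneg (k i : ℕ) (ω : Ω) : 0 ≤ condIncr P 𝓗 V k i ω := le_max_left _ _

lemma measurable_condIncr (k i : ℕ) : Measurable[𝓗 (grid ⊤ k i)] (condIncr P 𝓗 V k i) :=
  Measurable.max (@measurable_const _ _ _ (𝓗 (grid ⊤ k i)) _) stronglyMeasurable_condExp.measurable

/-- Each conditional increment is charged immediately after the left end of its interval, where it
is already known. -/
lemma isStronglyPredictable_discComp (k : ℕ) :
    IsStronglyPredictable 𝓗 (discComp P 𝓗 V k) := by
  rw [isStronglyPredictable_iff]
  have (i : ℕ) := isStronglyPredictable_iff.1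
    (isStronglyPredictable_indicator_Ioi (measurable_condIncr (P := P) (𝓗 := 𝓗) (V := V) k i))
  convert Finset.measurable_sum (Finset.range (2 ^ k)) fun i _ => this i using 1
  ext ⟨s, ω⟩
  simp [discComp]

lemma discComp_mono (k : ℕ) (ω : Ω) : Monotone fun t => discComp P 𝓗 V k t ω := by
  intro s t hst
  refine Finset.sum_le_sum fun i _ => ?_
  simp only [Set.indicator, Set.mem_Ioi]
  split_ifs with h1 h2
  · rfl
  · exact absurd (h1.trans_le hst) h2
  · exact condIncr_nonneg _ _ _
  · rfl

lemma discComp_bot (k : ℕ) (ω : Ω) : discComp P 𝓗 V k ⊥ ω = 0 := by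
  simp [discComp]

lemma discComp_grid (hT : (⊥ : TimeInterval T) < ⊤) (k : ℕ) {j : ℕ} (hj : j ≤ 2 ^ k) (ω : Ω) :
    discComp P 𝓗 V k (grid ⊤ k j) ω = ∑ i ∈ Finset.range j, condIncr P 𝓗 V k i ω := by
  simp only [discComp]
  rw [← Finset.sum_subset (Finset.range_mono hj)]
  · refine Finset.sum_congr rfl fun i hi => Set.indicator_of_mem ?_ _
    have hi' := Finset.mem_range.1 hi
    exact grid_lt_grid hT hi' (by omega)
  · intro i _ hi
    refine Set.indicator_of_notMem ?_ _
    rw [Set.mem_Ioi, not_lt]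
    exact grid_mono _ _ (by simpa using hi)

lemma discComp_top (hT : (⊥ : TimeInterval T) < ⊤) (k : ℕ) (ω : Ω) :
    discComp P 𝓗 V k ⊤ ω = ∑ i ∈ Finset.range (2 ^ k), condIncr P 𝓗 V k i ω := by
  rw [← discComp_grid hT k le_rfl, grid_of_le _ le_rfl]

/-- The truncation at `0` alters the conditional expectation only on a null set, while making every
path of the discrete compensator nondecreasing. -/
lemma condIncr_ae_eq (hV : IsIncreasingProcess V) (k i : ℕ) : condIncr P 𝓗 V k i =ᵐ[P]
    P[fun ω => V (grid ⊤ k (i + 1)) ω - V (grid ⊤ k i) ω | 𝓗 (grid ⊤ k i)] := by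
  have : 0 ≤ᵐ[P] P[fun ω => V (grid ⊤ k (i + 1)) ω - V (grid ⊤ k i) ω | 𝓗 (grid ⊤ k i)] :=
    condExp_nonneg (.of_forall fun ω => sub_nonneg.2 (hV.mono ω (grid_mono _ _ (Nat.le_succ i))))
  filter_upwards [this] with ω hω using max_eq_right hω

variable [IsProbabilityMeasure P] (hV : IsIncreasingProcess V) (hV1 : ∀ ω, V ⊤ ω ≤ 1)

include hV hV1

lemma integrable_of_le_one (t : TimeInterval T) : Integrable (V t) P := by
  refine Integrable.of_bound (hV.meas t).aestronglyMeasurable 1 (.of_forall fun ω => ?_)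
  rw [Real.norm_of_nonneg (hV.nonneg t ω)]
  exact (hV.le_top t ω).trans (hV1 ω)

lemma abs_sub_le_one (s t : TimeInterval T) (ω : Ω) : |V t ω - V s ω| ≤ 1 := by
  have h (r) : V r ω ≤ 1 := (hV.le_top r ω).trans (hV1 ω)
  rw [abs_le]
  constructor <;> linarith [h s, h t, hV.nonneg s ω, hV.nonneg t ω]

lemma integrable_increment (s t : TimeInterval T) : Integrable (fun ω => V t ω - V s ω) P :=
  (integrable_of_le_one hV hV1 t).sub (integrable_of_le_one hV hV1 s)

lemma condIncr_le_one (k i : ℕ) : ∀ᵐ ω ∂P, ‖condIncr P 𝓗 V k i ω‖ ≤ 1 := by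
  have := ae_bdd_abs_condExp_of_ae_bdd_abs (μ := P) (m := 𝓗 (grid ⊤ k i)) (R := (1 : ℝ))
    (f := fun ω => V (grid ⊤ k (i + 1)) ω - V (grid ⊤ k i) ω)
    (.of_forall fun ω => abs_sub_le_one hV hV1 _ _ ω)
  filter_upwards [this, condIncr_ae_eq hV k i (𝓗 := 𝓗)] with ω h1 h2
  rw [h2]
  simpa using h1

lemma integrable_condIncr (k i : ℕ) : Integrable (condIncr P 𝓗 V k i) P :=
  integrable_condExp.congr (condIncr_ae_eq hV k i).symm

lemma integrable_mul_condIncr {f : Ω → ℝ} (hf : Integrable f P) (k i : ℕ) :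
    Integrable (fun ω => f ω * condIncr P 𝓗 V k i ω) P :=
  hf.mul_bdd (integrable_condIncr hV hV1 k i).aestronglyMeasurable (condIncr_le_one hV hV1 k i)

lemma integral_mul_condIncr {f : Ω → ℝ} {k i : ℕ} (hf : Integrable f P)
    (hfm : AEStronglyMeasurable[𝓗 (grid ⊤ k i)] f P) :
    ∫ ω, f ω * condIncr P 𝓗 V k i ω ∂P =
      ∫ ω, f ω * (V (grid ⊤ k (i + 1)) ω - V (grid ⊤ k i) ω) ∂P := by
  have h1 := integrable_increment hV hV1 (P := P) (grid ⊤ k i) (grid ⊤ k (i + 1))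
  have h2 : Integrable (f * fun ω => V (grid ⊤ k (i + 1)) ω - V (grid ⊤ k i) ω) P :=
    hf.mul_bdd h1.aestronglyMeasurable (.of_forall fun ω => abs_sub_le_one hV hV1 _ _ ω)
  rw [← integral_mul_condExp (𝓗.le _) hfm h2 h1]
  refine integral_congr_ae ?_
  filter_upwards [condIncr_ae_eq hV k i (𝓗 := 𝓗) (P := P)] with ω hω
  rw [hω]

lemma memLp_discComp_top (hT : (⊥ : TimeInterval T) < ⊤) (k : ℕ) :
    MemLp (discComp P 𝓗 V k ⊤) 2 P := by
  rw [funext (discComp_top hT k)]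
  exact memLp_finsetSum _ fun i _ => MemLp.of_bound
    (integrable_condIncr hV hV1 k i).aestronglyMeasurable 1 (condIncr_le_one hV hV1 k i)

/-- The discrete compensators are bounded in `L²`. -/
lemma integral_discComp_top_sq_le (hT : (⊥ : TimeInterval T) < ⊤) (k : ℕ) :
    ∫ ω, discComp P 𝓗 V k ⊤ ω ^ 2 ∂P ≤ 2 := by
  set a : ℕ → Ω → ℝ := condIncr P 𝓗 V k with ha
  have hai (i) : Integrable (a i) P := integrable_condIncr hV hV1 k i
  have haa (i j) : Integrable (fun ω => a i ω * a j ω) P := integrable_mul_condIncr hV hV1 (hai i) k j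
  -- Expanding the square gives each product with `j < i` twice; the diagonal terms are counted
  -- twice as well, whence only an inequality.
  have hsq (ω) : discComp P 𝓗 V k ⊤ ω ^ 2 ≤ 2 * ∑ j ∈ Finset.range (2 ^ k),
      ∑ i ∈ Finset.Ico j (2 ^ k), a j ω * a i ω := by
    rw [discComp_top hT]
    generalize 2 ^ k = N
    induction N with
    | zero => simp
    | succ N ih =>
      rw [Finset.sum_range_succ, add_sq]
      have e : ∑ j ∈ Finset.range (N + 1), ∑ i ∈ Finset.Ico j (N + 1), a j ω * a i ω =
          ∑ j ∈ Finset.range N, ∑ i ∈ Finset.Ico j N, a j ω * a i ω +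
            (∑ j ∈ Finset.range N, a j ω) * a N ω + a N ω ^ 2 := by
        rw [Finset.sum_range_succ, Finset.sum_mul, ← Finset.sum_add_distrib]
        congr 1
        · refine Finset.sum_congr rfl fun j hj => ?_
          rw [Finset.sum_Ico_succ_top (Finset.mem_range.1 hj).le]
        · simp [sq]
      rw [e]
      nlinarith [sq_nonneg (a N ω)]
  -- For `i ≥ j` the factor `a j` is known at the `i`-th grid point, so `a i` may be replaced by the
  -- increment of `V`. The sum over `i` then telescopes to an increment at most `1`.
  have hj (j) (hj : j ∈ Finset.range (2 ^ k)) :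
      ∑ i ∈ Finset.Ico j (2 ^ k), ∫ ω, a j ω * a i ω ∂P ≤ ∫ ω, a j ω ∂P := by
    have e (i) (hi : i ∈ Finset.Ico j (2 ^ k)) : ∫ ω, a j ω * a i ω ∂P =
        ∫ ω, a j ω * (V (grid ⊤ k (i + 1)) ω - V (grid ⊤ k i) ω) ∂P := by
      refine integral_mul_condIncr hV hV1 (hai j) ?_
      exact ((measurable_condIncr k j).mono (𝓗.mono (grid_mono _ _ (Finset.mem_Ico.1 hi).1))
        le_rfl).aestronglyMeasurable
    have hint (i) : Integrable
        (fun ω => a j ω * (V (grid ⊤ k (i + 1)) ω - V (grid ⊤ k i) ω)) P :=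
      (hai j).mul_bdd (integrable_increment hV hV1 _ _).aestronglyMeasurable
        (.of_forall fun ω => abs_sub_le_one hV hV1 _ _ ω)
    rw [Finset.sum_congr rfl e, ← integral_finsetSum _ fun i _ => hint i]
    refine integral_mono (integrable_finsetSum _ fun i _ => hint i) (hai j) fun ω => ?_
    dsimp only
    rw [← Finset.mul_sum, Finset.sum_Ico_sub (fun i => V (grid ⊤ k i) ω)
      (Finset.mem_range.1 hj).le]
    exact mul_le_of_le_one_right (condIncr_nonneg _ _ _)
      ((le_abs_self _).trans (abs_sub_le_one hV hV1 _ _ ω))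
  have hsum : ∑ j ∈ Finset.range (2 ^ k), ∫ ω, a j ω ∂P ≤ 1 := by
    have e (j) : ∫ ω, a j ω ∂P = ∫ ω, (V (grid ⊤ k (j + 1)) ω - V (grid ⊤ k j) ω) ∂P := by
      rw [integral_congr_ae (condIncr_ae_eq hV k j), integral_condExp (𝓗.le _)]
    simp only [e]
    rw [← integral_finsetSum _ fun i _ => integrable_increment hV hV1 _ _]
    have e' (ω : Ω) : ∑ i ∈ Finset.range (2 ^ k), (V (grid ⊤ k (i + 1)) ω - V (grid ⊤ k i) ω) =
        V (grid ⊤ k (2 ^ k)) ω - V (grid ⊤ k 0) ω := Finset.sum_range_sub (fun i => V (grid ⊤ k i) ω) _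
    simp only [e']
    refine (integral_mono (integrable_increment hV hV1 _ _) (integrable_const 1)
      fun ω => (le_abs_self _).trans (abs_sub_le_one hV hV1 _ _ ω)).trans ?_
    simp
  calc ∫ ω, discComp P 𝓗 V k ⊤ ω ^ 2 ∂P
      ≤ ∫ ω, 2 * ∑ j ∈ Finset.range (2 ^ k), ∑ i ∈ Finset.Ico j (2 ^ k), a j ω * a i ω ∂P :=
        integral_mono (memLp_discComp_top hV hV1 hT k).integrable_sq
          ((integrable_finsetSum _ fun j _ => integrable_finsetSum _ fun i _ => haa j i).const_mul 2)
          hsq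
    _ = 2 * ∑ j ∈ Finset.range (2 ^ k), ∑ i ∈ Finset.Ico j (2 ^ k), ∫ ω, a j ω * a i ω ∂P := by
        rw [integral_const_mul,
          integral_finsetSum _ fun j _ => integrable_finsetSum _ fun i _ => haa j i]
        congr 1
        exact Finset.sum_congr rfl fun j _ => integral_finsetSum _ fun i _ => haa j i
    _ ≤ 2 * ∑ j ∈ Finset.range (2 ^ k), ∫ ω, a j ω ∂P := by gcongr with j hj'; exact hj j hj'
    _ ≤ 2 := by linarith

/-- The discrete compensator at a point of the subdivision in terms of its terminal value. -/
lemma discComp_grid_ae_eq (hT : (⊥ : TimeInterval T) < ⊤) (k : ℕ) {j : ℕ} (hj : j ≤ 2 ^ k) :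
    discComp P 𝓗 V k (grid ⊤ k j) =ᵐ[P]
      P[fun ω => discComp P 𝓗 V k ⊤ ω - (V ⊤ ω - V (grid ⊤ k j) ω) | 𝓗 (grid ⊤ k j)] := by
  -- The differences between conditional and actual increments after the `j`-th grid point have
  -- conditional expectation zero given `𝓗 (grid ⊤ k j)`, by the tower property.
  set Y : ℕ → Ω → ℝ := fun i =>
    condIncr P 𝓗 V k i - fun ω => V (grid ⊤ k (i + 1)) ω - V (grid ⊤ k i) ω with hY
  have hYi (i) : Integrable (Y i) P :=
    (integrable_condIncr hV hV1 k i).sub (integrable_increment hV hV1 _ _)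
  have hY0 (i) (hi : i ∈ Finset.Ico j (2 ^ k)) : P[Y i | 𝓗 (grid ⊤ k j)] =ᵐ[P] 0 := by
    have hle : 𝓗 (grid ⊤ k j) ≤ 𝓗 (grid ⊤ k i) :=
      𝓗.mono (grid_mono _ _ (Finset.mem_Ico.1 hi).1)
    have h1 := condExp_sub (m := 𝓗 (grid ⊤ k j)) (integrable_condIncr hV hV1 k i (𝓗 := 𝓗) (P := P))
      (integrable_increment hV hV1 (grid ⊤ k i) (grid ⊤ k (i + 1)))
    have h2 := condExp_congr_ae (m := 𝓗 (grid ⊤ k j))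
      (condIncr_ae_eq hV k i (𝓗 := 𝓗) (P := P))
    have h3 := condExp_condExp_of_le (μ := P) hle (𝓗.le _)
      (f := fun ω => V (grid ⊤ k (i + 1)) ω - V (grid ⊤ k i) ω)
    filter_upwards [h1, h2, h3] with ω e1 e2 e3
    rw [hY, e1, Pi.sub_apply, e2, e3, sub_self]
    rfl
  have hsumY : P[∑ i ∈ Finset.Ico j (2 ^ k), Y i | 𝓗 (grid ⊤ k j)] =ᵐ[P] 0 := by
    refine (condExp_finsetSum (fun i _ => hYi i) _).trans ?_
    have : ∀ᵐ ω ∂P, ∀ i ∈ Finset.Ico j (2 ^ k), (P[Y i | 𝓗 (grid ⊤ k j)]) ω = 0 :=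
      (ae_ball_iff (Finset.countable_toSet _)).2 hY0
    filter_upwards [this] with ω hω
    rw [Finset.sum_apply]
    exact Finset.sum_eq_zero hω
  have hdec : (fun ω => discComp P 𝓗 V k ⊤ ω - (V ⊤ ω - V (grid ⊤ k j) ω)) =
      discComp P 𝓗 V k (grid ⊤ k j) + ∑ i ∈ Finset.Ico j (2 ^ k), Y i := by
    ext ω
    simp only [hY, Pi.add_apply, Finset.sum_apply, Pi.sub_apply, Finset.sum_sub_distrib]
    rw [← Finset.sum_sub_distrib (f := fun i => V (grid ⊤ k (i + 1)) ω),
      Finset.sum_Ico_sub (fun i => V (grid ⊤ k i) ω) hj, grid_of_le _ le_rfl, discComp_top hT,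
      discComp_grid hT k hj, Finset.sum_Ico_eq_sub _ hj]
    ring
  have hmeas : StronglyMeasurable[𝓗 (grid ⊤ k j)] (discComp P 𝓗 V k (grid ⊤ k j)) :=
    (isStronglyPredictable_discComp k).stronglyAdapted _
  have hint : Integrable (discComp P 𝓗 V k (grid ⊤ k j)) P := by
    rw [funext (discComp_grid hT k hj)]
    exact integrable_finsetSum _ fun i _ => integrable_condIncr hV hV1 k i
  rw [hdec]
  have h1 := condExp_add (m := 𝓗 (grid ⊤ k j)) hint
    (integrable_finsetSum' (Finset.Ico j (2 ^ k)) fun i _ => hYi i)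
  rw [condExp_of_stronglyMeasurable (𝓗.le _) hmeas hint] at h1
  filter_upwards [h1, hsumY] with ω e1 e2
  rw [e1, Pi.add_apply, e2]
  simp

end Discrete

/-! ### A deterministic criterion for equality with the right-continuous version. -/

section Path

variable {T : ℝ≥0}

lemma ofReal_sub_limsup_le {x y : ℕ → ℝ} {c : ℝ} (hy : Tendsto y atTop (𝓝 c))
    (hx : IsBoundedUnder (· ≤ ·) atTop x) :
    ENNReal.ofReal (c - limsup x atTop) ≤ liminf (fun n => ENNReal.ofReal (y n - x n)) atTop := by
  have key (ε : ℝ) (hε : 0 < ε) : ENNReal.ofReal (c - limsup x atTop - ε) ≤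
      liminf (fun n => ENNReal.ofReal (y n - x n)) atTop := by
    refine le_liminf_of_le (by isBoundedDefault) ?_
    filter_upwards [eventually_lt_of_limsup_lt (show limsup x atTop < limsup x atTop + ε / 2 by
      linarith) hx, hy.eventually_const_lt (show c - ε / 2 < c by linarith)] with n h1 h2
    exact ENNReal.ofReal_le_ofReal (by linarith)
  have hlim : Tendsto (fun n : ℕ => ENNReal.ofReal (c - limsup x atTop - 1 / ((n : ℝ) + 1))) atTop
      (𝓝 (ENNReal.ofReal (c - limsup x atTop - 0))) :=
    ENNReal.tendsto_ofReal (tendsto_const_nhds.sub tendsto_one_div_add_atTop_nhds_zero_nat)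
  rw [sub_zero] at hlim
  exact le_of_tendsto' hlim fun n => key _ (by positivity)

/-- The lower Riemann sum of a path against its own increments. -/
noncomputable def selfSum (A : TimeInterval T → ℝ) (k : ℕ) : ℝ :=
  ∑ i ∈ Finset.range (2 ^ k), A (grid ⊤ k i) * (A (grid ⊤ k (i + 1)) - A (grid ⊤ k i))

/-- Summation by parts replaces the weight `A (grid ⊤ k i)` by `A ⊤ - A (grid ⊤ k (i + 1))`, the
infimum of `A ⊤ - A t` over the corresponding half-open cell. -/
lemma ofReal_selfSum_le (A : StieltjesFunction (TimeInterval T)) (hA : A ⊥ = 0) (k : ℕ) :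
    ENNReal.ofReal (selfSum A k) ≤ ∫⁻ t, ENNReal.ofReal (A ⊤ - A t) ∂A.measure := by
  have e1 : selfSum A k = ∑ i ∈ Finset.range (2 ^ k),
      (A ⊤ - A (grid ⊤ k (i + 1))) * (A (grid ⊤ k (i + 1)) - A (grid ⊤ k i)) := by
    have h1 := Finset.sum_range_sub (fun i => A (grid ⊤ k i) ^ 2) (2 ^ k)
    have h2 := Finset.sum_range_sub (fun i => A ⊤ * A (grid ⊤ k i)) (2 ^ k)
    simp only [grid_of_le _ le_rfl, grid_zero, hA] at h1 h2
    have h3 : ∑ i ∈ Finset.range (2 ^ k), ((A (grid ⊤ k (i + 1)) ^ 2 - A (grid ⊤ k i) ^ 2) -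
        (A ⊤ * A (grid ⊤ k (i + 1)) - A ⊤ * A (grid ⊤ k i))) = 0 := by
      rw [Finset.sum_sub_distrib, h1, h2]
      ring
    rw [selfSum, ← sub_eq_zero, ← Finset.sum_sub_distrib, ← h3]
    exact Finset.sum_congr rfl fun i _ => by ring
  have hstep (j : ℕ) : ∑ i ∈ Finset.range j, ENNReal.ofReal ((A ⊤ - A (grid ⊤ k (i + 1))) *
      (A (grid ⊤ k (i + 1)) - A (grid ⊤ k i))) ≤
      ∫⁻ t in Set.Ioc ⊥ (grid ⊤ k j), ENNReal.ofReal (A ⊤ - A t) ∂A.measure := by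
    induction j with
    | zero => simp
    | succ j ih =>
      rw [Finset.sum_range_succ, ← Set.Ioc_union_Ioc_eq_Ioc bot_le (grid_mono _ _ (Nat.le_succ j)),
        lintegral_union measurableSet_Ioc (Set.Ioc_disjoint_Ioc_of_le le_rfl)]
      refine add_le_add ih ?_
      rw [ENNReal.ofReal_mul (sub_nonneg.2 (A.mono le_top)), ← A.measure_Ioc (grid ⊤ k j) (grid ⊤ k (j + 1)),
        ← setLIntegral_const]
      refine setLIntegral_mono' measurableSet_Ioc fun t ht => ENNReal.ofReal_le_ofReal ?_
      exact sub_le_sub_left (A.mono ht.2) _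
  rw [e1, ENNReal.ofReal_sum_of_nonneg fun i _ => mul_nonneg (sub_nonneg.2 (A.mono le_top))
    (sub_nonneg.2 (A.mono (grid_mono _ _ (Nat.le_succ i))))]
  exact (hstep _).trans (setLIntegral_le_lintegral _ _)

variable {A : StieltjesFunction (TimeInterval T)} {B : TimeInterval T → ℝ}
  {h : ℕ → TimeInterval T → ℝ}

lemma lintegral_le_liminf (hh : ∀ n, Measurable (h n))
    (hlim : ∀ t, ENNReal.ofReal (A ⊤ - B t) ≤
      liminf (fun n => ENNReal.ofReal (h n ⊤ - h n t)) atTop) :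
    ∫⁻ t, ENNReal.ofReal (A ⊤ - B t) ∂A.measure ≤
      liminf (fun n => ∫⁻ t, ENNReal.ofReal (h n ⊤ - h n t) ∂A.measure) atTop :=
  (lintegral_mono hlim).trans
    (lintegral_liminf_le fun n => (measurable_const.sub (hh n)).ennreal_ofReal)

lemma iSup_selfSum_le_liminf (hA : A ⊥ = 0) (hBA : ∀ t, B t ≤ A t) (hh : ∀ n, Measurable (h n))
    (hlim : ∀ t, ENNReal.ofReal (A ⊤ - B t) ≤
      liminf (fun n => ENNReal.ofReal (h n ⊤ - h n t)) atTop) :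
    ⨆ k, ENNReal.ofReal (selfSum A k) ≤
      liminf (fun n => ∫⁻ t, ENNReal.ofReal (h n ⊤ - h n t) ∂A.measure) atTop := by
  refine (iSup_le fun k => ofReal_selfSum_le A hA k).trans (le_trans ?_ (lintegral_le_liminf hh hlim))
  exact lintegral_mono fun t => ENNReal.ofReal_le_ofReal (sub_le_sub_left (hBA t) _)

/-- The assumption closes a circle of inequalities between the integrals of `A ⊤ - A` and `A ⊤ - B`,
so `B = A` almost everywhere for `A.measure`. If they differed at `t`, then `t` would not be an
atom, so `A` would equal its left limit there. But `B t` dominates the values of `A` at dyadic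
points to the left, hence that left limit, a contradiction. -/
lemma eq_of_liminf_le (hA : A ⊥ = 0) (hB : Monotone B) (hBA : ∀ t, B t ≤ A t)
    (hgrid : ∀ k i, B (grid ⊤ k i) = A (grid ⊤ k i)) (hh : ∀ n, Measurable (h n))
    (hlim : ∀ t, ENNReal.ofReal (A ⊤ - B t) ≤
      liminf (fun n => ENNReal.ofReal (h n ⊤ - h n t)) atTop)
    (hle : liminf (fun n => ∫⁻ t, ENNReal.ofReal (h n ⊤ - h n t) ∂A.measure) atTop ≤
      ⨆ k, ENNReal.ofReal (selfSum A k)) (t : TimeInterval T) : B t = A t := by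
  have hfin : IsFiniteMeasure A.measure := by
    refine ⟨?_⟩
    rw [← Set.Icc_bot_top, A.measure_Icc]
    exact ENNReal.ofReal_lt_top
  have hpos (s) : 0 ≤ A s := hA.symm.le.trans (A.mono bot_le)
  have hJ : ∫⁻ t, ENNReal.ofReal (A ⊤ - A t) ∂A.measure ≠ ∞ := by
    refine ((lintegral_mono (g := fun _ => ENNReal.ofReal (A ⊤)) fun s =>
      ENNReal.ofReal_le_ofReal (by linarith [hpos s])).trans_lt ?_).ne
    rw [lintegral_const]
    exact ENNReal.mul_lt_top ENNReal.ofReal_lt_top (measure_lt_top _ _)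
  have hae : (fun t => ENNReal.ofReal (A ⊤ - A t)) =ᵐ[A.measure]
      fun t => ENNReal.ofReal (A ⊤ - B t) := by
    refine ae_eq_of_ae_le_of_lintegral_le (.of_forall fun s =>
      ENNReal.ofReal_le_ofReal (sub_le_sub_left (hBA s) _)) hJ
      (measurable_const.sub hB.measurable).ennreal_ofReal.aemeasurable ?_
    exact (lintegral_le_liminf hh hlim).trans
      (hle.trans (iSup_le fun k => ofReal_selfSum_le A hA k))
  have hae' : ∀ᵐ t ∂A.measure, B t = A t := by
    filter_upwards [hae] with s hs
    have h1 : A ⊤ - A s = A ⊤ - B s := by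
      rwa [ENNReal.ofReal_eq_ofReal_iff (sub_nonneg.2 (A.mono le_top))
        (sub_nonneg.2 ((hBA s).trans (A.mono le_top)))] at hs
    linarith
  by_contra hne
  have h0 : A.measure {t} = 0 := measure_mono_null (by simpa using hne) hae'
  rw [A.measure_singleton, ENNReal.ofReal_eq_zero, sub_nonpos] at h0
  have hbt : ⊥ < t := by
    refine bot_lt_iff_ne_bot.2 fun h => hne ?_
    have := hgrid 0 0
    rw [grid_zero] at this
    rwa [h]
  have hcell := tendsto_grid_cell hbt le_top
  have h1 := (A.mono.tendsto_leftLim t).comp hcell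
  have h2 : Function.leftLim A t ≤ B t := by
    refine le_of_tendsto' h1 fun k => ?_
    rw [Function.comp_apply, ← hgrid]
    exact hB (cell_spec hbt le_top).2.1.le
  exact hne (le_antisymm (hBA t) (h0.trans h2))

end Path

/-! ### Convex combinations and their limits at dyadic times. -/

section Combination

variable {T : ℝ≥0} {Ω : Type*} {m : MeasurableSpace Ω} {P : Measure Ω}
  {𝓗 : Filtration (TimeInterval T) m} {V : TimeInterval T → Ω → ℝ}

variable (𝓗 P V) in
/-- A convex combination of discrete compensators. -/
noncomputable def combComp (w : ℕ →₀ ℝ) (t : TimeInterval T) (ω : Ω) : ℝ :=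
  w.sum fun k a => a * discComp P 𝓗 V k t ω

lemma isStronglyPredictable_combComp (w : ℕ →₀ ℝ) :
    IsStronglyPredictable 𝓗 (combComp P 𝓗 V w) := by
  rw [isStronglyPredictable_iff]
  have (k : ℕ) := (isStronglyPredictable_iff.1
    (isStronglyPredictable_discComp (P := P) (𝓗 := 𝓗) (V := V) k)).const_mul (w k)
  convert Finset.measurable_sum w.support fun k _ => this k using 1
  ext ⟨s, ω⟩
  simp [combComp, Finsupp.sum, Function.uncurry]

lemma combComp_mono {w : ℕ →₀ ℝ} (hw : ∀ k, 0 ≤ w k) (ω : Ω) :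
    Monotone fun t => combComp P 𝓗 V w t ω := fun _ _ hst =>
  Finset.sum_le_sum fun k _ => mul_le_mul_of_nonneg_left (discComp_mono k ω hst) (hw k)

lemma combComp_bot (w : ℕ →₀ ℝ) (ω : Ω) : combComp P 𝓗 V w ⊥ ω = 0 := by
  simp [combComp, discComp_bot]

lemma measure_Iic_of_bot (A : StieltjesFunction (TimeInterval T)) (hA : A ⊥ = 0)
    (t : TimeInterval T) : A.measure.real (Set.Iic t) = A t := by
  have e : Set.Iic t = Set.Icc ⊥ t := Set.Icc_bot.symm
  rw [e, measureReal_def, A.measure_Icc, leftLim_eq_of_isBot isBot_bot, hA, sub_zero,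
    ENNReal.toReal_ofReal (hA.symm.le.trans (A.mono bot_le))]

/-- A jump located just after a grid point `q` contributes to the remaining increase exactly for `t
≤ q`, a set of mass `A q`. -/
lemma lintegral_combComp (hT : (⊥ : TimeInterval T) < ⊤) {w : ℕ →₀ ℝ} (hw : ∀ k, 0 ≤ w k)
    (A : StieltjesFunction (TimeInterval T)) (hA : A ⊥ = 0) (ω : Ω) :
    ∫⁻ t, ENNReal.ofReal (combComp P 𝓗 V w ⊤ ω - combComp P 𝓗 V w t ω) ∂A.measure =
      ENNReal.ofReal (w.sum fun k a => a * ∑ i ∈ Finset.range (2 ^ k),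
        A (grid ⊤ k i) * condIncr P 𝓗 V k i ω) := by
  have hfin : IsFiniteMeasure A.measure := by
    refine ⟨?_⟩
    rw [← Set.Icc_bot_top, A.measure_Icc]
    exact ENNReal.ofReal_lt_top
  have e (t) : combComp P 𝓗 V w ⊤ ω - combComp P 𝓗 V w t ω = ∑ k ∈ w.support, w k *
      ∑ i ∈ Finset.range (2 ^ k),
        (Set.Iic (grid ⊤ k i)).indicator (fun _ => condIncr P 𝓗 V k i ω) t := by
    simp only [combComp, Finsupp.sum]
    rw [← Finset.sum_sub_distrib]
    refine Finset.sum_congr rfl fun k _ => ?_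
    rw [← mul_sub, discComp_top hT, discComp, ← Finset.sum_sub_distrib]
    congr 1
    refine Finset.sum_congr rfl fun i _ => ?_
    by_cases h : t ≤ grid ⊤ k i
    · simp [h, h.not_gt]
    · simp [h, not_le.1 h]
  have hint (k i : ℕ) : Integrable ((Set.Iic (grid ⊤ k i)).indicator
      fun _ => condIncr P 𝓗 V k i ω) A.measure := (integrable_const _).indicator measurableSet_Iic
  rw [← ofReal_integral_eq_lintegral_ofReal]
  · simp only [e]
    rw [integral_finsetSum _ fun k _ => (integrable_finsetSum _ fun i _ => hint k i).const_mul _]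
    congr 1
    refine Finset.sum_congr rfl fun k _ => ?_
    rw [integral_const_mul, integral_finsetSum _ fun i _ => hint k i]
    congr 1
    refine Finset.sum_congr rfl fun i _ => ?_
    rw [integral_indicator_const _ measurableSet_Iic, measure_Iic_of_bot A hA, smul_eq_mul]
  · simp only [e]
    exact integrable_finsetSum _ fun k _ => (integrable_finsetSum _ fun i _ => hint k i).const_mul _
  · exact .of_forall fun t => sub_nonneg.2 (combComp_mono hw ω le_top)

variable (𝓗 P V) in
/-- The candidate for the compensator of `V` with terminal value `g`. -/
noncomputable def limComp (g : Ω → ℝ) (t : TimeInterval T) : Ω → ℝ :=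
  P[fun ω => g ω - (V ⊤ ω - V t ω) | 𝓗 t]

/-- A sequence converging geometrically fast in `L¹` converges almost surely. -/
lemma ae_tendsto_of_eLpNorm_le_pow {f : ℕ → Ω → ℝ} {f' : Ω → ℝ} (hf : ∀ n, AEStronglyMeasurable (f n) P)
    (hf' : AEStronglyMeasurable f' P) {N : ℕ}
    (h : ∀ n ≥ N, eLpNorm (f n - f') 1 P ≤ 2⁻¹ ^ n) :
    ∀ᵐ ω ∂P, Tendsto (fun n => f n ω) atTop (𝓝 (f' ω)) := by
  have hm0 (n : ℕ) : AEMeasurable (fun ω => ‖f (n + N) ω - f' ω‖ₑ) P :=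
    ((hf (n + N)).sub hf').enorm
  have hsum : ∫⁻ ω, ∑' n, ‖f (n + N) ω - f' ω‖ₑ ∂P ≠ ∞ := by
    rw [lintegral_tsum hm0]
    have : ∑' n, ∫⁻ ω, ‖f (n + N) ω - f' ω‖ₑ ∂P ≤ ∑' n : ℕ, 2⁻¹ ^ n := by
      refine ENNReal.tsum_le_tsum fun n => ?_
      have h1 := h (n + N) (Nat.le_add_left _ _)
      rw [eLpNorm_one_eq_lintegral_enorm] at h1
      refine h1.trans ?_
      rw [pow_add]
      exact mul_le_of_le_one_right' (pow_le_one₀ zero_le (by simp))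
    refine (this.trans_lt ?_).ne
    rw [ENNReal.tsum_geometric]
    simp
  have hm : AEMeasurable (fun ω => ∑' n, ‖f (n + N) ω - f' ω‖ₑ) P :=
    AEMeasurable.tsum hm0
  filter_upwards [ae_lt_top' hm hsum] with ω hω
  have h0 := ENNReal.tendsto_atTop_zero_of_tsum_ne_top hω.ne
  rw [← tendsto_add_atTop_iff_nat N, tendsto_iff_edist_tendsto_0]
  simpa only [edist_eq_enorm_sub] using h0

variable [IsProbabilityMeasure P] (hV : IsIncreasingProcess V) (hV1 : ∀ ω, V ⊤ ω ≤ 1)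

include hV hV1

lemma memLp_combComp_top (hT : (⊥ : TimeInterval T) < ⊤) (w : ℕ →₀ ℝ) :
    MemLp (combComp P 𝓗 V w ⊤) 2 P :=
  memLp_finsetSum _ fun k _ => (memLp_discComp_top hV hV1 hT k).const_mul (w k)

lemma exists_combComp_tendsto (hT : (⊥ : TimeInterval T) < ⊤) :
    ∃ (w : ℕ → ℕ →₀ ℝ) (g : Ω → ℝ), MemLp g 2 P ∧ (∀ n k, 0 ≤ w n k) ∧
      (∀ n, ∀ k < n, w n k = 0) ∧ (∀ n, (w n).sum (fun _ a => a) = 1) ∧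
      ∀ n, eLpNorm (combComp P 𝓗 V (w n) ⊤ - g) 1 P ≤ 2⁻¹ ^ n := by
  let F (k : ℕ) : Lp ℝ 2 P := (memLp_discComp_top hV hV1 hT k (𝓗 := 𝓗)).toLp _
  have hF (k) : ‖F k‖ ≤ √2 := by
    refine Real.le_sqrt_of_sq_le ?_
    rw [← real_inner_self_eq_norm_sq, L2.inner_def]
    refine le_trans (le_of_eq ?_) (integral_discComp_top_sq_le hV hV1 hT k (𝓗 := 𝓗) (P := P))
    refine integral_congr_ae ?_
    filter_upwards [(memLp_discComp_top hV hV1 hT k (𝓗 := 𝓗) (P := P)).coeFn_toLp] with ω hω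
    simp only [F, hω]
    simp [sq]
  obtain ⟨y, hy⟩ := exists_forward_convex_combination F hF
  -- The precision `2⁻¹ ^ n` is summable, so almost sure convergence will hold without passing to a
  -- subsequence.
  choose w hw0 hwn hw1 hwy using fun n : ℕ => hy n (2⁻¹ ^ n) (by positivity)
  set g : Ω → ℝ := ⇑y
  refine ⟨w, g, Lp.memLp y, hw0, hwn, hw1, fun n => ?_⟩
  have hcoe : ((w n).sum fun k a => a • F k : Lp ℝ 2 P) =ᵐ[P] combComp P 𝓗 V (w n) ⊤ := by
    have h1 : ∀ᵐ ω ∂P, ∀ k, F k ω = discComp P 𝓗 V k ⊤ ω := ae_all_iff.2 fun k =>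
      (memLp_discComp_top hV hV1 hT k (𝓗 := 𝓗) (P := P)).coeFn_toLp
    have h2 : ∀ᵐ ω ∂P, ∀ k, (w n k • F k : Lp ℝ 2 P) ω = w n k * F k ω := ae_all_iff.2 fun k => by
      filter_upwards [Lp.coeFn_smul (w n k) (F k)] with ω hω
      rw [hω]
      rfl
    have h3 := Lp.coeFn_finsetSum (w n).support fun k => w n k • F k
    filter_upwards [h1, h2, h3] with ω e1 e2 e3
    simp only [Finsupp.sum, combComp]
    rw [e3]
    simp [e1, e2]
  have hnorm : eLpNorm (combComp P 𝓗 V (w n) ⊤ - g) 2 P ≤ 2⁻¹ ^ n := by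
    have h1 := (hwy n).le
    rw [Lp.norm_def] at h1
    have h2 : eLpNorm (((w n).sum fun k a => a • F k) - y : Lp ℝ 2 P) 2 P =
        eLpNorm (combComp P 𝓗 V (w n) ⊤ - g) 2 P := by
      refine eLpNorm_congr_ae ?_
      filter_upwards [hcoe, Lp.coeFn_sub ((w n).sum fun k a => a • F k) y] with ω e1 e2
      rw [e2, Pi.sub_apply, Pi.sub_apply, e1]
    rw [h2] at h1
    rw [← ENNReal.ofReal_toReal
      ((memLp_combComp_top hV hV1 hT (w n)).sub (Lp.memLp y)).eLpNorm_ne_top]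
    refine (ENNReal.ofReal_le_ofReal h1).trans_eq ?_
    rw [ENNReal.ofReal_pow (by norm_num), ENNReal.ofReal_inv_of_pos (by norm_num)]
    simp
  refine le_trans (eLpNorm_le_eLpNorm_of_exponent_le one_le_two ?_) hnorm
  exact ((memLp_combComp_top hV hV1 hT (w n)).sub (Lp.memLp y)).aestronglyMeasurable

/-- Only subdivisions at least as fine as the `k`-th carry weight, and all of them contain the point
in question. Since the weights sum to one, the increment of `V` passes through the combination
unchanged. -/
lemma combComp_grid_ae_eq (hT : (⊥ : TimeInterval T) < ⊤) {w : ℕ →₀ ℝ} {n k j : ℕ}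
    (hw : ∀ i < n, w i = 0) (hw1 : w.sum (fun _ a => a) = 1) (hkn : k ≤ n) :
    combComp P 𝓗 V w (grid ⊤ k j) =ᵐ[P] limComp P 𝓗 V (combComp P 𝓗 V w ⊤) (grid ⊤ k j) := by
  wlog hj : j ≤ 2 ^ k generalizing j
  · have := this (j := 2 ^ k) le_rfl
    have e : grid (⊤ : TimeInterval T) k j = grid ⊤ k (2 ^ k) := by
      rw [grid_of_le _ le_rfl, grid_of_le _ (not_le.1 hj).le]
    rwa [e]
  set q : TimeInterval T := grid ⊤ k j with hq
  have hX (i : ℕ) : Integrable (fun ω => discComp P 𝓗 V i ⊤ ω - (V ⊤ ω - V q ω)) P :=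
    ((memLp_discComp_top hV hV1 hT i).integrable one_le_two).sub (integrable_increment hV hV1 _ _)
  have h1 : ∀ᵐ ω ∂P, ∀ i ∈ w.support, discComp P 𝓗 V i q ω =
      (P[fun ω => discComp P 𝓗 V i ⊤ ω - (V ⊤ ω - V q ω) | 𝓗 q]) ω := by
    refine (ae_ball_iff (Finset.countable_toSet _)).2 fun i hi => ?_
    have hki : k ≤ i := hkn.trans (not_lt.1 fun h => Finsupp.mem_support_iff.1 hi (hw i h))
    have hle : 2 ^ (i - k) * j ≤ 2 ^ i := by
      calc 2 ^ (i - k) * j ≤ 2 ^ (i - k) * 2 ^ k := by gcongr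
        _ = 2 ^ i := by rw [← pow_add, Nat.sub_add_cancel hki]
    have := discComp_grid_ae_eq hV hV1 hT i hle (𝓗 := 𝓗) (P := P)
    rwa [grid_refine _ hki] at this
  have hdec : (fun ω => combComp P 𝓗 V w ⊤ ω - (V ⊤ ω - V q ω)) =
      ∑ i ∈ w.support, w i • fun ω => discComp P 𝓗 V i ⊤ ω - (V ⊤ ω - V q ω) := by
    ext ω
    simp only [combComp, Finsupp.sum, Finset.sum_apply, Pi.smul_apply, smul_eq_mul, mul_sub,
      Finset.sum_sub_distrib] at hw1 ⊢
    rw [← Finset.sum_mul, ← Finset.sum_mul, hw1, one_mul, one_mul]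
  have h2 := condExp_finsetSum (fun i (_ : i ∈ w.support) => (hX i).smul (w i)) (𝓗 q)
  have h3 : ∀ᵐ ω ∂P, ∀ i, (P[w i • fun ω => discComp P 𝓗 V i ⊤ ω - (V ⊤ ω - V q ω) | 𝓗 q]) ω =
      w i * (P[fun ω => discComp P 𝓗 V i ⊤ ω - (V ⊤ ω - V q ω) | 𝓗 q]) ω :=
    ae_all_iff.2 fun i => condExp_smul (w i) _ _
  filter_upwards [h1, h2, h3] with ω e1 e2 e3
  rw [limComp, hdec, e2, Finset.sum_apply]
  refine Finset.sum_congr rfl fun i hi => ?_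
  rw [e3]
  beta_reduce
  rw [e1 i hi]

/-- Conditional expectation contracts `L¹`, so the geometric rate at the terminal time is inherited
at each dyadic time from some index on. -/
lemma ae_tendsto_combComp (hT : (⊥ : TimeInterval T) < ⊤) {w : ℕ → ℕ →₀ ℝ} {g : Ω → ℝ}
    (hg : MemLp g 2 P) (hw : ∀ n, ∀ k < n, w n k = 0) (hw1 : ∀ n, (w n).sum (fun _ a => a) = 1)
    (hwg : ∀ n, eLpNorm (combComp P 𝓗 V (w n) ⊤ - g) 1 P ≤ 2⁻¹ ^ n) :
    ∀ᵐ ω ∂P, ∀ k j, Tendsto (fun n => combComp P 𝓗 V (w n) (grid ⊤ k j) ω) atTop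
      (𝓝 (limComp P 𝓗 V g (grid ⊤ k j) ω)) := by
  refine ae_all_iff.2 fun k => ae_all_iff.2 fun j => ?_
  refine ae_tendsto_of_eLpNorm_le_pow (N := k) (fun n => ?_)
    integrable_condExp.aestronglyMeasurable fun n hn => ?_
  · exact (((isStronglyPredictable_combComp (w n)).stronglyAdapted _).mono
      (𝓗.le _)).aestronglyMeasurable
  · refine le_trans (le_of_eq ?_) ((eLpNorm_condExp_le_eLpNorm (m := 𝓗 (grid ⊤ k j))
      (combComp P 𝓗 V (w n) ⊤ - g) le_rfl).trans (hwg n))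
    refine eLpNorm_congr_ae ?_
    have hi1 : Integrable (fun ω => combComp P 𝓗 V (w n) ⊤ ω - (V ⊤ ω - V (grid ⊤ k j) ω)) P :=
      ((memLp_combComp_top hV hV1 hT (w n)).integrable one_le_two).sub
        (integrable_increment hV hV1 _ _)
    have hi2 : Integrable (fun ω => g ω - (V ⊤ ω - V (grid ⊤ k j) ω)) P :=
      (hg.integrable one_le_two).sub (integrable_increment hV hV1 _ _)
    have e : combComp P 𝓗 V (w n) ⊤ - g =
        (fun ω => combComp P 𝓗 V (w n) ⊤ ω - (V ⊤ ω - V (grid ⊤ k j) ω)) -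
          fun ω => g ω - (V ⊤ ω - V (grid ⊤ k j) ω) := by
      ext ω
      simp
    rw [e]
    filter_upwards [combComp_grid_ae_eq hV hV1 hT (j := j) (hw n) (hw1 n) hn,
      condExp_sub (m := 𝓗 (grid ⊤ k j)) hi1 hi2] with ω e1 e2
    rw [e2, Pi.sub_apply, Pi.sub_apply, e1]
    rfl

end Combination

/-! ### Upper limits of increasing paths that converge at dyadic times. -/

section Limsup

variable {T : ℝ≥0} {h : ℕ → TimeInterval T → ℝ} {l : TimeInterval T → ℝ}

/-- A sequence of nondecreasing paths started at `0` which converges at the dyadic points. -/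
structure ConvergesOnGrid (h : ℕ → TimeInterval T → ℝ) (l : TimeInterval T → ℝ) : Prop where
  mono : ∀ n, Monotone (h n)
  bot : ∀ n, h n ⊥ = 0
  tendsto : ∀ k j, Tendsto (fun n => h n (grid ⊤ k j)) atTop (𝓝 (l (grid ⊤ k j)))

namespace ConvergesOnGrid

lemma tendsto_top (hh : ConvergesOnGrid h l) : Tendsto (fun n => h n ⊤) atTop (𝓝 (l ⊤)) := by
  have := hh.tendsto 0 (2 ^ 0)
  rwa [grid_of_le _ le_rfl] at this

lemma isBoundedUnder_le (hh : ConvergesOnGrid h l) (t : TimeInterval T) :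
    IsBoundedUnder (· ≤ ·) atTop fun n => h n t :=
  hh.tendsto_top.isBoundedUnder_le.mono_le (.of_forall fun n => hh.mono n le_top)

lemma isCoboundedUnder_le (hh : ConvergesOnGrid h l) (t : TimeInterval T) :
    IsCoboundedUnder (· ≤ ·) atTop fun n => h n t :=
  IsBoundedUnder.isCoboundedUnder_le
    (isBoundedUnder_of ⟨0, fun n => (hh.bot n).symm.le.trans (hh.mono n bot_le)⟩)

lemma limsup_mono (hh : ConvergesOnGrid h l) : Monotone fun t => limsup (fun n => h n t) atTop :=
  fun s t hst => limsup_le_limsup (.of_forall fun n => hh.mono n hst) (hh.isCoboundedUnder_le s)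
    (hh.isBoundedUnder_le t)

lemma limsup_grid (hh : ConvergesOnGrid h l) (k j : ℕ) :
    limsup (fun n => h n (grid ⊤ k j)) atTop = l (grid ⊤ k j) := (hh.tendsto k j).limsup_eq

lemma limsup_bot (hh : ConvergesOnGrid h l) : limsup (fun n => h n ⊥) atTop = 0 := by
  simp [hh.bot]

lemma grid_nonneg (hh : ConvergesOnGrid h l) (k j : ℕ) : 0 ≤ l (grid ⊤ k j) := by
  rw [← hh.limsup_grid, ← hh.limsup_bot]
  exact hh.limsup_mono bot_le

lemma grid_le_grid (hh : ConvergesOnGrid h l) {k j k' j' : ℕ}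
    (hle : grid (⊤ : TimeInterval T) k j ≤ grid ⊤ k' j') :
    l (grid ⊤ k j) ≤ l (grid ⊤ k' j') := by
  rw [← hh.limsup_grid, ← hh.limsup_grid]
  exact hh.limsup_mono hle

lemma selfSum_nonneg (hh : ConvergesOnGrid h l) (k : ℕ) : 0 ≤ selfSum l k :=
  Finset.sum_nonneg fun i _ => mul_nonneg (hh.grid_nonneg k i)
    (sub_nonneg.2 (hh.grid_le_grid (grid_mono _ _ (Nat.le_succ i))))

lemma selfSum_le (hh : ConvergesOnGrid h l) (k : ℕ) : selfSum l k ≤ l ⊤ ^ 2 := by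
  have e : (⊤ : TimeInterval T) = grid ⊤ k (2 ^ k) := (grid_of_le _ le_rfl).symm
  have e0 : l (grid ⊤ k 0) = 0 := by
    rw [← hh.limsup_grid, grid_zero, hh.limsup_bot]
  calc selfSum l k ≤ ∑ i ∈ Finset.range (2 ^ k),
        l ⊤ * (l (grid ⊤ k (i + 1)) - l (grid ⊤ k i)) := by
        refine Finset.sum_le_sum fun i _ => mul_le_mul_of_nonneg_right ?_
          (sub_nonneg.2 (hh.grid_le_grid (grid_mono _ _ (Nat.le_succ i))))
        have := hh.grid_le_grid (k := k) (j := i) (k' := k) (j' := 2 ^ k)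
          ((grid_of_le (⊤ : TimeInterval T) (le_refl (2 ^ k))).symm ▸ le_top)
        rwa [grid_of_le _ le_rfl] at this
    _ = l ⊤ ^ 2 := by
        rw [← Finset.mul_sum, Finset.sum_range_sub (fun i => l (grid ⊤ k i)), e0,
          grid_of_le _ le_rfl]
        ring

section

variable (hh : ConvergesOnGrid h l)
  (hr : ∀ k j, Function.rightLim (fun t => limsup (fun n => h n t) atTop) (grid ⊤ k j) =
    l (grid ⊤ k j))

include hr

lemma stieltjesFunction_grid (k j : ℕ) :
    hh.limsup_mono.stieltjesFunction (grid ⊤ k j) = l (grid ⊤ k j) := by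
  rw [hh.limsup_mono.stieltjesFunction_eq, hr]

lemma stieltjesFunction_bot : hh.limsup_mono.stieltjesFunction ⊥ = 0 := by
  rw [← grid_zero (⊤ : TimeInterval T) 0, hh.stieltjesFunction_grid hr, ← hh.limsup_grid, grid_zero,
    hh.limsup_bot]

lemma ofReal_sub_limsup_le_liminf (t : TimeInterval T) :
    ENNReal.ofReal (hh.limsup_mono.stieltjesFunction ⊤ - limsup (fun n => h n t) atTop) ≤
      liminf (fun n => ENNReal.ofReal (h n ⊤ - h n t)) atTop := by
  refine ofReal_sub_limsup_le ?_ (hh.isBoundedUnder_le t)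
  have := hh.stieltjesFunction_grid hr 0 (2 ^ 0)
  rw [grid_of_le _ le_rfl] at this
  rw [this]
  exact hh.tendsto_top

lemma iSup_selfSum_le_liminf_lintegral :
    ⨆ k, ENNReal.ofReal (selfSum l k) ≤ liminf (fun n =>
      ∫⁻ t, ENNReal.ofReal (h n ⊤ - h n t) ∂hh.limsup_mono.stieltjesFunction.measure) atTop := by
  have e (k) : selfSum l k = selfSum hh.limsup_mono.stieltjesFunction k := by
    simp only [selfSum, hh.stieltjesFunction_grid hr]
  simp only [e]
  refine iSup_selfSum_le_liminf (hh.stieltjesFunction_bot hr) (fun t => ?_)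
    (fun n => (hh.mono n).measurable) (hh.ofReal_sub_limsup_le_liminf hr)
  rw [hh.limsup_mono.stieltjesFunction_eq]
  exact hh.limsup_mono.le_rightLim le_rfl

lemma limsup_eq_rightLim (hle : liminf (fun n =>
    ∫⁻ t, ENNReal.ofReal (h n ⊤ - h n t) ∂hh.limsup_mono.stieltjesFunction.measure) atTop ≤
      ⨆ k, ENNReal.ofReal (selfSum l k)) (t : TimeInterval T) :
    limsup (fun n => h n t) atTop =
      Function.rightLim (fun t => limsup (fun n => h n t) atTop) t := by
  have e (k) : selfSum l k = selfSum hh.limsup_mono.stieltjesFunction k := by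
    simp only [selfSum, hh.stieltjesFunction_grid hr]
  simp only [e] at hle
  rw [← hh.limsup_mono.stieltjesFunction_eq]
  refine eq_of_liminf_le (hh.stieltjesFunction_bot hr) hh.limsup_mono (fun t => ?_) (fun k j => ?_)
    (fun n => (hh.mono n).measurable) (hh.ofReal_sub_limsup_le_liminf hr) hle t
  · rw [hh.limsup_mono.stieltjesFunction_eq]
    exact hh.limsup_mono.le_rightLim le_rfl
  · rw [hh.stieltjesFunction_grid hr, hh.limsup_grid]

end

end ConvergesOnGrid

end Limsup

/-! ### Compensators of bounded increasing processes. -/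

section Compensator

variable {T : ℝ≥0} {Ω : Type*} {m : MeasurableSpace Ω} {P : Measure Ω}
  {𝓗 : Filtration (TimeInterval T) m} {V A : TimeInterval T → Ω → ℝ}

lemma isStronglyPredictable_indicator {S : Set Ω} (hS : MeasurableSet[𝓗 ⊥] S)
    (hV : IsStronglyPredictable 𝓗 V) : IsStronglyPredictable 𝓗 fun t => S.indicator (V t) := by
  classical
  rw [isStronglyPredictable_iff] at hV ⊢
  have hone : Measurable[𝓗 ⊥] (S.indicator fun _ => (1 : ℝ)) :=
    (@measurable_const _ _ _ (𝓗 ⊥) _).indicator hS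
  convert hV.mul (isStronglyPredictable_iff.1 (isStronglyPredictable_const hone)) using 1
  ext ⟨t, ω⟩
  by_cases h : ω ∈ S <;> simp [h]

lemma IsIncreasingProcess.indicator {S : Set Ω} (hS : MeasurableSet S)
    (hm : ∀ t, Measurable (V t)) (hbot : ∀ ω ∈ S, V ⊥ ω = 0)
    (hmono : ∀ ω ∈ S, Monotone fun t => V t ω)
    (hc : ∀ ω ∈ S, ∀ t, ContinuousWithinAt (fun t => V t ω) (Set.Ici t) t) :
    IsIncreasingProcess fun t => S.indicator (V t) := by
  classical
  refine ⟨fun ω => ?_, fun ω t => ?_, fun ω => ?_, fun t => (hm t).indicator hS⟩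
  · by_cases h : ω ∈ S
    · simpa only [Set.indicator_of_mem h] using hmono ω h
    · simpa only [Set.indicator_of_notMem h] using monotone_const
  · by_cases h : ω ∈ S
    · simpa only [Set.indicator_of_mem h] using hc ω h t
    · simpa only [Set.indicator_of_notMem h] using continuousWithinAt_const
  · by_cases h : ω ∈ S
    · simpa only [Set.indicator_of_mem h] using hbot ω h
    · simp [h]


/-- This is why the candidate is built as an upper limit at all times: extending the dyadic values
by right limits would not make predictability evident. -/
lemma isStronglyPredictable_limsup {h : ℕ → TimeInterval T → Ω → ℝ}
    (hh : ∀ n, IsStronglyPredictable 𝓗 (h n)) :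
    IsStronglyPredictable 𝓗 fun t ω => limsup (fun n => h n t ω) atTop := by
  rw [isStronglyPredictable_iff]
  exact Measurable.limsup fun n => isStronglyPredictable_iff.1 (hh n)

lemma tendsto_setLIntegral_sub (hV : IsIncreasingProcess V)
    (hi : ∫⁻ ω, ENNReal.ofReal (V ⊤ ω) ∂P ≠ ∞) {q : ℕ → TimeInterval T} {s : TimeInterval T}
    (hq : Tendsto q atTop (𝓝[>] s)) (C : Set Ω) :
    Tendsto (fun n => ∫⁻ ω in C, ENNReal.ofReal (V ⊤ ω - V (q n) ω) ∂P) atTop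
      (𝓝 (∫⁻ ω in C, ENNReal.ofReal (V ⊤ ω - V s ω) ∂P)) := by
  refine tendsto_lintegral_of_dominated_convergence (fun ω => ENNReal.ofReal (V ⊤ ω))
    (fun n => ((hV.meas _).sub (hV.meas _)).ennreal_ofReal)
    (fun n => .of_forall fun ω => ENNReal.ofReal_le_ofReal (by linarith [hV.nonneg (q n) ω]))
    ((setLIntegral_le_lintegral _ _).trans_lt hi.lt_top).ne (.of_forall fun ω => ?_)
  refine ENNReal.tendsto_ofReal (tendsto_const_nhds.sub ?_)
  exact (hV.rightCont ω s).tendsto.comp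
    (hq.mono_right (nhdsWithin_mono _ Set.Ioi_subset_Ici_self))

/-- A general `s < ⊤` is approached from the right by dyadic `q`; a set in `𝓗 s` belongs to each `𝓗
q`, and right-continuity with dominated convergence passes to the limit. -/
lemma HaveSameProjection.of_grid (hV : IsIncreasingProcess V) (hA : IsIncreasingProcess A)
    (hVi : ∫⁻ ω, ENNReal.ofReal (V ⊤ ω) ∂P ≠ ∞)
    (h : ∀ k j C, MeasurableSet[𝓗 (grid ⊤ k j)] C →
      ∫⁻ ω in C, ENNReal.ofReal (V ⊤ ω - V (grid ⊤ k j) ω) ∂P =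
        ∫⁻ ω in C, ENNReal.ofReal (A ⊤ ω - A (grid ⊤ k j) ω) ∂P) :
    HaveSameProjection 𝓗 P V A := by
  have hAi : ∫⁻ ω, ENNReal.ofReal (A ⊤ ω) ∂P ≠ ∞ := by
    have := h 0 0 Set.univ .univ
    simp only [grid_zero, hV.bot, hA.bot, sub_zero, Measure.restrict_univ] at this
    rwa [← this]
  intro s C hC
  rcases eq_top_or_lt_top s with rfl | hs
  · simp
  · obtain ⟨q, hq, hqs⟩ := exists_grid_seq_gt hs
    refine tendsto_nhds_unique (tendsto_setLIntegral_sub hV hVi hqs C) ?_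
    simpa only [h _ _ _ (𝓗.mono (hq _).le _ hC)] using tendsto_setLIntegral_sub hA hAi hqs C

variable [IsProbabilityMeasure P] (hV : IsIncreasingProcess V) (hV1 : ∀ ω, V ⊤ ω ≤ 1)
  {g : Ω → ℝ} (hg : MemLp g 2 P)

include hV hV1 hg

lemma memLp_sub_increment (t : TimeInterval T) :
    MemLp (fun ω => g ω - (V ⊤ ω - V t ω)) 2 P :=
  hg.sub (MemLp.of_bound (integrable_increment hV hV1 _ _).aestronglyMeasurable 1
    (.of_forall fun ω => abs_sub_le_one hV hV1 _ _ ω))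

lemma memLp_limComp (t : TimeInterval T) : MemLp (limComp P 𝓗 V g t) 2 P :=
  (memLp_sub_increment hV hV1 hg t).condExp one_le_two

lemma integrable_limComp (t : TimeInterval T) : Integrable (limComp P 𝓗 V g t) P :=
  (memLp_limComp hV hV1 hg t).integrable one_le_two

lemma setIntegral_limComp_sub {s t : TimeInterval T} (hst : s ≤ t) {C : Set Ω}
    (hC : MeasurableSet[𝓗 s] C) :
    ∫ ω in C, (limComp P 𝓗 V g t ω - limComp P 𝓗 V g s ω) ∂P = ∫ ω in C, (V t ω - V s ω) ∂P := by
  have hi (r) := (memLp_sub_increment hV hV1 hg r).integrable one_le_two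
  rw [integral_sub (integrable_limComp hV hV1 hg t).integrableOn
    (integrable_limComp hV hV1 hg s).integrableOn, limComp, limComp,
    setIntegral_condExp (𝓗.le _) (hi t) (𝓗.mono hst _ hC), setIntegral_condExp (𝓗.le _) (hi s) hC,
    ← integral_sub (hi t).integrableOn (hi s).integrableOn]
  congr 1 with ω
  ring

/-- The weight is known at the left end of the interval, so the conditional increment may be
replaced by that of `V`. That in turn may be replaced by the increment of `limComp`, which has the
same conditional expectation. -/
lemma integral_selfSum_limComp (k : ℕ) :
    ∫ ω, ∑ i ∈ Finset.range (2 ^ k), limComp P 𝓗 V g (grid ⊤ k i) ω * condIncr P 𝓗 V k i ω ∂P =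
      ∫ ω, selfSum (fun t => limComp P 𝓗 V g t ω) k ∂P := by
  have hL (s t) : Integrable (fun ω => limComp P 𝓗 V g s ω * limComp P 𝓗 V g t ω) P :=
    (memLp_limComp hV hV1 hg s).integrable_mul (memLp_limComp hV hV1 hg t)
  have hX (s t) : Integrable (fun ω => limComp P 𝓗 V g s ω * (g ω - (V ⊤ ω - V t ω))) P :=
    (memLp_limComp hV hV1 hg s).integrable_mul (memLp_sub_increment hV hV1 hg t)
  simp only [selfSum]
  rw [integral_finsetSum _ fun i _ => integrable_mul_condIncr hV hV1
      (integrable_limComp hV hV1 hg _) k i, integral_finsetSum]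
  · refine Finset.sum_congr rfl fun i _ => ?_
    have hm (t) : StronglyMeasurable[𝓗 t] (limComp P 𝓗 V g t) := stronglyMeasurable_condExp
    have hpair {s t : TimeInterval T} (hst : s ≤ t) :
        ∫ ω, limComp P 𝓗 V g s ω * limComp P 𝓗 V g t ω ∂P =
          ∫ ω, limComp P 𝓗 V g s ω * (g ω - (V ⊤ ω - V t ω)) ∂P :=
      integral_mul_condExp (𝓗.le t) ((hm s).mono (𝓗.mono hst)).aestronglyMeasurable (hX s t)
        ((memLp_sub_increment hV hV1 hg t).integrable one_le_two)
    rw [integral_mul_condIncr hV hV1 (integrable_limComp hV hV1 hg _)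
      (hm _).aestronglyMeasurable]
    simp only [mul_sub (limComp P 𝓗 V g (grid ⊤ k i) _) (limComp P 𝓗 V g (grid ⊤ k (i + 1)) _)]
    rw [integral_sub (hL _ _) (hL _ _), hpair (grid_mono _ _ (Nat.le_succ i)), hpair le_rfl,
      ← integral_sub (hX _ _) (hX _ _)]
    congr 1 with ω
    ring
  · intro i _
    simp only [mul_sub]
    exact (hL _ _).sub (hL _ _)

lemma integrable_selfSum_limComp (k : ℕ) :
    Integrable (fun ω => selfSum (fun t => limComp P 𝓗 V g t ω) k) P := by
  refine integrable_finsetSum _ fun i _ => ?_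
  exact (memLp_limComp hV hV1 hg _).integrable_mul
    ((memLp_limComp hV hV1 hg _).sub (memLp_limComp hV hV1 hg _))

/-- The combined lower sums are integrable. -/
lemma integrable_sum_limComp_mul_condIncr (w : ℕ →₀ ℝ) :
    Integrable (fun ω => w.sum fun k a => a * ∑ i ∈ Finset.range (2 ^ k),
      limComp P 𝓗 V g (grid ⊤ k i) ω * condIncr P 𝓗 V k i ω) P :=
  integrable_finsetSum _ fun k _ => (integrable_finsetSum _ fun i _ =>
    integrable_mul_condIncr hV hV1 (integrable_limComp hV hV1 hg _) k i).const_mul _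

section

variable {h : ℕ → TimeInterval T → Ω → ℝ}
  (hh : ∀ᵐ ω ∂P, ConvergesOnGrid (fun n t => h n t ω) fun t => limComp P 𝓗 V g t ω)

include hh

/-- As `r` decreases to a dyadic `s`, the expected increment of `limComp` equals that of `V` and
tends to zero by right-continuity. Fatou's lemma then shows that the right jump, which is
nonnegative, vanishes almost surely. -/
lemma ae_rightLim_limsup_grid :
    ∀ᵐ ω ∂P, ∀ k j, Function.rightLim (fun t => limsup (fun n => h n t ω) atTop) (grid ⊤ k j) =
      limComp P 𝓗 V g (grid ⊤ k j) ω := by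
  refine ae_all_iff.2 fun k => ae_all_iff.2 fun j => ?_
  rcases eq_top_or_lt_top (grid (⊤ : TimeInterval T) k j) with htop | hlt
  · filter_upwards [hh] with ω hω
    rw [← hω.limsup_grid, rightLim_eq_of_eq_bot]
    rw [htop]
    simp
  · obtain ⟨q, hq, hqs⟩ := exists_grid_seq_gt hlt
    set s : TimeInterval T := grid ⊤ k j with hs
    set r : ℕ → TimeInterval T := fun i => grid ⊤ (q i).1 (q i).2 with hr
    have hLm (t) : Measurable (limComp P 𝓗 V g t) :=
      (stronglyMeasurable_condExp.mono (𝓗.le t)).measurable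
    have hm (i : ℕ) : Measurable fun ω =>
        ENNReal.ofReal (limComp P 𝓗 V g (r i) ω - limComp P 𝓗 V g s ω) :=
      ((hLm _).sub (hLm _)).ennreal_ofReal
    have hint (i : ℕ) : ∫⁻ ω, ENNReal.ofReal (limComp P 𝓗 V g (r i) ω - limComp P 𝓗 V g s ω) ∂P =
        ENNReal.ofReal (∫ ω, (V (r i) ω - V s ω) ∂P) := by
      rw [← ofReal_integral_eq_lintegral_ofReal
        (f := fun ω => limComp P 𝓗 V g (r i) ω - limComp P 𝓗 V g s ω)
        ((integrable_limComp hV hV1 hg _).sub (integrable_limComp hV hV1 hg _))]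
      · have := setIntegral_limComp_sub hV hV1 hg (𝓗 := 𝓗) (hq i).le (@MeasurableSet.univ _ (𝓗 s))
        simp only [Measure.restrict_univ] at this
        rw [← this]
      · filter_upwards [hh] with ω hω
        exact sub_nonneg.2 (hω.grid_le_grid (hq i).le)
    have hlim : Tendsto (fun i => ENNReal.ofReal (∫ ω, (V (r i) ω - V s ω) ∂P)) atTop (𝓝 0) := by
      have : Tendsto (fun i => ∫ ω, (V (r i) ω - V s ω) ∂P) atTop (𝓝 (∫ _, (0 : ℝ) ∂P)) := by
        refine tendsto_integral_of_dominated_convergence (fun _ => 1)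
          (fun i => (integrable_increment hV hV1 _ _).aestronglyMeasurable) (integrable_const 1)
          (fun i => .of_forall fun ω => abs_sub_le_one hV hV1 _ _ ω) (.of_forall fun ω => ?_)
        rw [← sub_self (V s ω)]
        exact ((hV.rightCont ω s).tendsto.comp
          (hqs.mono_right (nhdsWithin_mono _ Set.Ioi_subset_Ici_self))).sub_const _
      simpa using ENNReal.tendsto_ofReal this
    have h0 : ∫⁻ ω, liminf (fun i =>
        ENNReal.ofReal (limComp P 𝓗 V g (r i) ω - limComp P 𝓗 V g s ω)) atTop ∂P = 0 := by
      refine le_antisymm ((lintegral_liminf_le hm).trans ?_) zero_le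
      simp only [hint]
      exact hlim.liminf_eq.le
    rw [lintegral_eq_zero_iff (Measurable.liminf hm)] at h0
    filter_upwards [hh, h0] with ω hω h0ω
    have ht : Tendsto (fun i => limComp P 𝓗 V g (r i) ω) atTop
        (𝓝 (Function.rightLim (fun t => limsup (fun n => h n t ω) atTop) s)) := by
      have := (hω.limsup_mono.tendsto_rightLim s).comp hqs
      refine this.congr fun i => ?_
      exact hω.limsup_grid _ _
    have h2 := (ENNReal.tendsto_ofReal (ht.sub_const (limComp P 𝓗 V g s ω))).liminf_eq
    rw [h2] at h0ω
    refine le_antisymm (sub_nonpos.1 (ENNReal.ofReal_eq_zero.1 h0ω)) ?_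
    rw [← hω.limsup_grid k j]
    exact hω.limsup_mono.le_rightLim le_rfl

lemma lintegral_iSup_selfSum_ne_top :
    ∫⁻ ω, ⨆ k, ENNReal.ofReal (selfSum (fun t => limComp P 𝓗 V g t ω) k) ∂P ≠ ∞ := by
  refine ((lintegral_mono_ae (g := fun ω => ENNReal.ofReal (limComp P 𝓗 V g ⊤ ω ^ 2)) ?_).trans_lt
    ?_).ne
  · filter_upwards [hh] with ω hω
    exact iSup_le fun k => ENNReal.ofReal_le_ofReal (hω.selfSum_le k)
  · exact (memLp_limComp hV hV1 hg ⊤).integrable_sq.lintegral_lt_top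

/-- In expectation each lower sum against the discrete compensator is the self sum of the same
level, hence below the expected supremum; a convex combination keeps the bound. -/
lemma lintegral_sum_limComp_mul_condIncr_le {w : ℕ →₀ ℝ} (hw : ∀ k, 0 ≤ w k)
    (hw1 : w.sum (fun _ a => a) = 1) :
    ∫⁻ ω, ENNReal.ofReal (w.sum fun k a => a * ∑ i ∈ Finset.range (2 ^ k),
      limComp P 𝓗 V g (grid ⊤ k i) ω * condIncr P 𝓗 V k i ω) ∂P ≤
      ∫⁻ ω, ⨆ k, ENNReal.ofReal (selfSum (fun t => limComp P 𝓗 V g t ω) k) ∂P := by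
  rw [← ofReal_integral_eq_lintegral_ofReal (integrable_sum_limComp_mul_condIncr hV hV1 hg w)]
  · refine ENNReal.ofReal_le_of_le_toReal ?_
    have hk (k : ℕ) : ∫ ω, selfSum (fun t => limComp P 𝓗 V g t ω) k ∂P ≤
        (∫⁻ ω, ⨆ k, ENNReal.ofReal (selfSum (fun t => limComp P 𝓗 V g t ω) k) ∂P).toReal := by
      rw [integral_eq_lintegral_of_nonneg_ae (hh.mono fun ω hω => hω.selfSum_nonneg k)
        (integrable_selfSum_limComp hV hV1 hg k).aestronglyMeasurable]
      exact ENNReal.toReal_mono (lintegral_iSup_selfSum_ne_top hV hV1 hg hh)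
        (lintegral_mono fun ω => le_iSup (fun k => ENNReal.ofReal (selfSum _ k)) k)
    simp only [Finsupp.sum] at hw1 ⊢
    rw [integral_finsetSum _ fun k _ => (integrable_finsetSum _ fun i _ =>
      integrable_mul_condIncr hV hV1 (integrable_limComp hV hV1 hg _) k i).const_mul _]
    simp only [integral_const_mul, integral_selfSum_limComp hV hV1 hg]
    refine (Finset.sum_le_sum fun k _ => mul_le_mul_of_nonneg_left (hk k) (hw k)).trans_eq ?_
    rw [← Finset.sum_mul, hw1, one_mul]
  · filter_upwards [hh] with ω hω
    exact Finset.sum_nonneg fun k _ => mul_nonneg (hw k) (Finset.sum_nonneg fun i _ =>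
      mul_nonneg (hω.grid_nonneg k i) (condIncr_nonneg k i ω))

end

lemma ae_rightLim_limsup_combComp (hT : (⊥ : TimeInterval T) < ⊤) {w : ℕ → ℕ →₀ ℝ}
    (hw : ∀ n k, 0 ≤ w n k) (hw1 : ∀ n, (w n).sum (fun _ a => a) = 1)
    (hconv : ∀ᵐ ω ∂P, ConvergesOnGrid (fun n t => combComp P 𝓗 V (w n) t ω)
      fun t => limComp P 𝓗 V g t ω) :
    ∀ᵐ ω ∂P, ∀ t, limsup (fun n => combComp P 𝓗 V (w n) t ω) atTop =
      Function.rightLim (fun t => limsup (fun n => combComp P 𝓗 V (w n) t ω) atTop) t := by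
  set F : ℕ → Ω → ℝ≥0∞ := fun n ω => ENNReal.ofReal ((w n).sum fun k a =>
    a * ∑ i ∈ Finset.range (2 ^ k), limComp P 𝓗 V g (grid ⊤ k i) ω * condIncr P 𝓗 V k i ω) with hF
  set D : Ω → ℝ≥0∞ := fun ω =>
    ⨆ k, ENNReal.ofReal (selfSum (fun t => limComp P 𝓗 V g t ω) k) with hD
  have hFm (n) : Measurable (F n) := by
    refine (Finset.measurable_sum _ fun k _ => (Finset.measurable_sum _ fun i _ =>
      Measurable.mul ?_ ?_).const_mul _).ennreal_ofReal
    · exact (stronglyMeasurable_condExp.mono (𝓗.le _)).measurable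
    · exact (measurable_condIncr k i).mono (𝓗.le _) le_rfl
  have hgrid := ae_rightLim_limsup_grid hV hV1 hg hconv
  have hint : ∀ᵐ ω ∂P, ∀ h : ConvergesOnGrid (fun n t => combComp P 𝓗 V (w n) t ω)
      (fun t => limComp P 𝓗 V g t ω), ∀ n,
      ∫⁻ t, ENNReal.ofReal (combComp P 𝓗 V (w n) ⊤ ω - combComp P 𝓗 V (w n) t ω)
        ∂h.limsup_mono.stieltjesFunction.measure = F n ω := by
    filter_upwards [hgrid] with ω hω h n
    rw [lintegral_combComp hT (hw n) _ (h.stieltjesFunction_bot hω)]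
    simp only [hF, h.stieltjesFunction_grid hω]
  -- Pathwise `D` is at most the liminf of `F n`. Fatou's lemma gives the reverse inequality in
  -- expectation, and as `D` has finite integral the two agree almost surely.
  have hDF : D =ᵐ[P] fun ω => liminf (fun n => F n ω) atTop := by
    refine ae_eq_of_ae_le_of_lintegral_le ?_ (lintegral_iSup_selfSum_ne_top hV hV1 hg hconv)
      (Measurable.liminf hFm).aemeasurable ?_
    · filter_upwards [hconv, hgrid, hint] with ω h hr hi
      simpa only [hi h] using h.iSup_selfSum_le_liminf_lintegral hr
    · refine (lintegral_liminf_le hFm).trans ?_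
      refine (liminf_le_liminf (.of_forall fun n =>
        lintegral_sum_limComp_mul_condIncr_le hV hV1 hg hconv (hw n) (hw1 n))).trans_eq ?_
      exact liminf_const _
  filter_upwards [hconv, hgrid, hint, hDF] with ω h hr hi hDω
  refine h.limsup_eq_rightLim hr ?_
  simpa only [hi h] using hDω.ge

end Compensator

variable {T : ℝ≥0} {Ω : Type*} {m : MeasurableSpace Ω} {P : Measure Ω}
  {𝓗 : Filtration (TimeInterval T) m}

/-- Every increasing process bounded by `1` has a predictable compensator. -/
lemma exists_predictable_of_bounded [IsProbabilityMeasure P]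
    (hc : ∀ N, P N = 0 → MeasurableSet[𝓗 ⊥] N) {V : TimeInterval T → Ω → ℝ}
    (hV : IsIncreasingProcess V) (hV1 : ∀ ω, V ⊤ ω ≤ 1) :
    ∃ A, IsIncreasingProcess A ∧ IsStronglyPredictable 𝓗 A ∧ HaveSameProjection 𝓗 P V A := by
  -- If `T = 0` the grid points all coincide and the zero process works.
  rcases (bot_le : (⊥ : TimeInterval T) ≤ ⊤).eq_or_lt with hT | hT
  · have hz (s : TimeInterval T) (ω : Ω) : V s ω = 0 := by
      rw [le_bot_iff.1 (le_top.trans_eq hT.symm : s ≤ ⊥), hV.bot]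
    refine ⟨fun _ _ => 0, ⟨fun _ => monotone_const, fun _ _ => continuousWithinAt_const,
      fun _ => rfl, fun _ => measurable_const⟩, ?_, fun s C _ => by simp [hz]⟩
    rw [isStronglyPredictable_iff]
    exact @measurable_const _ _ _ 𝓗.predictable _
  obtain ⟨w, g, hg, hw, hwn, hw1, hwg⟩ := exists_combComp_tendsto hV hV1 hT (P := P) (𝓗 := 𝓗)
  have hconv : ∀ᵐ ω ∂P, ConvergesOnGrid (fun n t => combComp P 𝓗 V (w n) t ω)
      fun t => limComp P 𝓗 V g t ω := by
    filter_upwards [ae_tendsto_combComp hV hV1 hT hg hwn hw1 hwg] with ω hω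
    exact ⟨fun n => combComp_mono (hw n) ω, fun n => combComp_bot (w n) ω, hω⟩
  set B : TimeInterval T → Ω → ℝ := fun t ω => limsup (fun n => combComp P 𝓗 V (w n) t ω) atTop
    with hB
  have hBpred : IsStronglyPredictable 𝓗 B :=
    isStronglyPredictable_limsup fun n => isStronglyPredictable_combComp (w n)
  set S : Set Ω := {ω | ConvergesOnGrid (fun n t => combComp P 𝓗 V (w n) t ω)
    (fun t => limComp P 𝓗 V g t ω) ∧ ∀ t, B t ω = Function.rightLim (fun t => B t ω) t} with hS
  have hSae : ∀ᵐ ω ∂P, ω ∈ S := by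
    filter_upwards [hconv, ae_rightLim_limsup_combComp hV hV1 hg hT hw hw1 hconv] with ω h1 h2
    exact ⟨h1, h2⟩
  -- Completeness puts the good set in the initial σ-algebra, so restricting to it preserves
  -- predictability.
  have hSm : MeasurableSet[𝓗 ⊥] S := by
    have := (hc Sᶜ hSae).compl
    rwa [compl_compl] at this
  have hA : IsIncreasingProcess fun t => S.indicator (B t) := by
    refine IsIncreasingProcess.indicator (𝓗.le _ _ hSm)
      (fun t => ((hBpred.stronglyAdapted t).mono (𝓗.le t)).measurable)
      (fun ω hω => hω.1.limsup_bot) (fun ω hω => hω.1.limsup_mono) fun ω hω t => ?_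
    rw [← continuousWithinAt_Ioi_iff_Ici, hω.1.limsup_mono.continuousWithinAt_Ioi_iff_rightLim_eq]
    exact (hω.2 t).symm
  refine ⟨_, hA, isStronglyPredictable_indicator hSm hBpred,
    HaveSameProjection.of_grid hV hA (integrable_of_le_one hV hV1 ⊤).lintegral_lt_top.ne
      fun k j C hC => ?_⟩
  have hCm := 𝓗.le _ _ hC
  set q : TimeInterval T := grid ⊤ k j with hq
  have e1 : ∫⁻ ω in C, ENNReal.ofReal (S.indicator (B ⊤) ω - S.indicator (B q) ω) ∂P =
      ∫⁻ ω in C, ENNReal.ofReal (limComp P 𝓗 V g ⊤ ω - limComp P 𝓗 V g q ω) ∂P := by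
    refine lintegral_congr_ae (ae_restrict_of_ae ?_)
    filter_upwards [hSae] with ω hω
    rw [Set.indicator_of_mem hω, Set.indicator_of_mem hω]
    have h1 : B ⊤ ω = limComp P 𝓗 V g ⊤ ω := hω.1.tendsto_top.limsup_eq
    have h2 : B q ω = limComp P 𝓗 V g q ω := hω.1.limsup_grid k j
    rw [h1, h2]
  rw [e1, ← ofReal_integral_eq_lintegral_ofReal
      (f := fun ω => limComp P 𝓗 V g ⊤ ω - limComp P 𝓗 V g q ω)
      ((integrable_limComp hV hV1 hg _).sub (integrable_limComp hV hV1 hg _)).integrableOn,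
    setIntegral_limComp_sub hV hV1 hg le_top hC,
    ofReal_integral_eq_lintegral_ofReal (integrable_increment hV hV1 _ _).integrableOn]
  · exact .of_forall fun ω => sub_nonneg.2 (hV.le_top _ _)
  · refine ae_restrict_of_ae ?_
    filter_upwards [hconv] with ω hω
    have := hω.grid_le_grid (k := k) (j := j) (k' := 0) (j' := 2 ^ 0)
      ((grid_of_le (⊤ : TimeInterval T) (le_refl (2 ^ 0))).symm ▸ le_top)
    rw [grid_of_le _ le_rfl] at this
    exact sub_nonneg.2 this

/-! ### Compensators of integrable increasing processes. -/

section Existence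

variable {T : ℝ≥0} {Ω : Type*} {m : MeasurableSpace Ω} {P : Measure Ω}
  {𝓗 : Filtration (TimeInterval T) m} {V A : TimeInterval T → Ω → ℝ}

/-- The part of an increasing process between the levels `k` and `k + 1`. -/
noncomputable def levelPart (V : TimeInterval T → Ω → ℝ) (k : ℕ) (t : TimeInterval T) (ω : Ω) : ℝ :=
  min (V t ω) (k + 1) - min (V t ω) k

lemma levelPart_mono (k : ℕ) : Monotone fun x : ℝ => min x (k + 1) - min x k := by
  intro x y hxy
  dsimp only
  rcases le_total x k with h1 | h1 <;> rcases le_total y k with h2 | h2 <;>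
  rcases le_total x (k + 1) with h3 | h3 <;> rcases le_total y (k + 1) with h4 | h4 <;>
  simp [h1, h2, h3, h4] <;> linarith

lemma IsIncreasingProcess.levelPart (hV : IsIncreasingProcess V) (k : ℕ) :
    IsIncreasingProcess (levelPart V k) where
  mono ω := (levelPart_mono k).comp (hV.mono ω)
  rightCont ω t := ((hV.rightCont ω t).min continuousWithinAt_const).sub
    ((hV.rightCont ω t).min continuousWithinAt_const)
  bot ω := by
    have : (0 : ℝ) ≤ k := by positivity
    simp [PredictableDualProjection.levelPart, hV.bot, this, add_nonneg this zero_le_one]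
  meas t := ((hV.meas t).min measurable_const).sub ((hV.meas t).min measurable_const)

lemma levelPart_le_one (k : ℕ) (t : TimeInterval T) (ω : Ω) : levelPart V k t ω ≤ 1 := by
  unfold levelPart
  rcases le_total (V t ω) k with h1 | h1 <;> rcases le_total (V t ω) (k + 1) with h3 | h3 <;>
  simp [h1, h3] <;> linarith

lemma hasSum_levelPart (hV : IsIncreasingProcess V) (t : TimeInterval T) (ω : Ω) :
    HasSum (fun k => levelPart V k t ω) (V t ω) := by
  rw [hasSum_iff_tendsto_nat_of_nonneg fun k => (hV.levelPart k).nonneg t ω]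
  have e (n : ℕ) : ∑ k ∈ Finset.range n, levelPart V k t ω = min (V t ω) n := by
    have := Finset.sum_range_sub (fun k : ℕ => min (V t ω) (k : ℝ)) n
    push_cast at this
    simp only [levelPart]
    rw [this, min_eq_right (hV.nonneg t ω), sub_zero]
  simp only [e]
  obtain ⟨n, hn⟩ := exists_nat_ge (V t ω)
  refine tendsto_const_nhds.congr' ?_
  filter_upwards [eventually_ge_atTop n] with k hk
  exact (min_eq_left (hn.trans (by exact_mod_cast hk))).symm

lemma HaveSameProjection.integrable_top (hV : IsIncreasingProcess V) (hA : IsIncreasingProcess A)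
    (hi : Integrable (V ⊤) P) (h : HaveSameProjection 𝓗 P V A) : Integrable (A ⊤) P := by
  have e := h ⊥ Set.univ .univ
  simp only [hV.bot, hA.bot, sub_zero, Measure.restrict_univ] at e
  refine ⟨(hA.meas ⊤).aestronglyMeasurable, ?_⟩
  rw [hasFiniteIntegral_iff_ofReal (.of_forall fun ω => hA.nonneg ⊤ ω), ← e]
  exact hi.lintegral_lt_top

/-- **Existence of the compensator** of an integrable increasing process. -/
theorem exists_predictable_increasing [IsProbabilityMeasure P]
    (hc : ∀ N : Set Ω, P N = 0 → MeasurableSet[𝓗 ⊥] N)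
    (hV : IsIncreasingProcess V) (hi : Integrable (V ⊤) P) :
    ∃ A, IsIncreasingProcess A ∧ IsStronglyPredictable 𝓗 A ∧ HaveSameProjection 𝓗 P V A := by
  classical
  choose A hA hAp hAV using fun k => exists_predictable_of_bounded hc (hV.levelPart k)
    fun ω => levelPart_le_one k ⊤ ω
  let S : Set Ω := {ω | ∑' k, ENNReal.ofReal (A k ⊤ ω) ≠ ∞}
  have hofReal (k t) : Measurable fun ω => ENNReal.ofReal (A k t ω) := ((hA k).meas t).ennreal_ofReal
  -- The compensators of the levels have the same expected terminal values as the levels, and these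
  -- add up to the expectation of `V ⊤`.
  have hSae : ∀ᵐ ω ∂P, ω ∈ S := by
    refine (ae_lt_top (Measurable.tsum fun k => hofReal k ⊤) ?_).mono fun ω h => h.ne
    rw [lintegral_tsum fun k => (hofReal k ⊤).aemeasurable]
    have e (k : ℕ) : ∫⁻ ω, ENNReal.ofReal (A k ⊤ ω) ∂P =
        ∫⁻ ω, ENNReal.ofReal (levelPart V k ⊤ ω) ∂P := by
      have := hAV k ⊥ Set.univ .univ
      simpa [(hV.levelPart k).bot, (hA k).bot] using this.symm
    simp only [e]
    rw [← lintegral_tsum fun k => (((hV.levelPart k).meas ⊤).ennreal_ofReal).aemeasurable]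
    refine ne_of_eq_of_ne (lintegral_congr fun ω => ?_) hi.lintegral_lt_top.ne
    rw [← ENNReal.ofReal_tsum_of_nonneg (fun k => (hV.levelPart k).nonneg ⊤ ω)
      (hasSum_levelPart hV ⊤ ω).summable, (hasSum_levelPart hV ⊤ ω).tsum_eq]
  have hS : MeasurableSet[𝓗 ⊥] S := by
    rw [← compl_compl S]
    exact (hc _ (ae_iff.1 hSae)).compl
  have hsummable {ω} (h : ω ∈ S) : Summable fun k => A k ⊤ ω := by
    have := ENNReal.summable_toReal h
    simpa only [ENNReal.toReal_ofReal ((hA _).nonneg ⊤ ω)] using this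
  have hsummable' {ω} (h : ω ∈ S) (t) : Summable fun k => A k t ω :=
    (hsummable h).of_nonneg_of_le (fun k => (hA k).nonneg t ω) fun k => (hA k).le_top t ω
  -- Summing in `ℝ≥0∞` makes `B` predictable irrespective of convergence. The identity `hB` holds
  -- for all `ω`, since a divergent series has value `0` on both sides.
  let B : TimeInterval T → Ω → ℝ := fun t ω => (∑' k, ENNReal.ofReal (A k t ω)).toReal
  have hB {ω} (t) : B t ω = ∑' k, A k t ω := by
    simp only [B]
    rw [ENNReal.tsum_toReal_eq fun k => ENNReal.ofReal_ne_top]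
    simp only [ENNReal.toReal_ofReal ((hA _).nonneg t ω)]
  have hBp : IsStronglyPredictable 𝓗 B := by
    rw [isStronglyPredictable_iff]
    exact (@Measurable.tsum _ _ _ 𝓗.predictable _ _ _ _ _ _ _ _ _ _ _ _ fun k =>
      (isStronglyPredictable_iff.1 (hAp k)).ennreal_ofReal).ennreal_toReal
  refine ⟨fun t => S.indicator (B t), ?_, isStronglyPredictable_indicator hS hBp, ?_⟩
  · refine IsIncreasingProcess.indicator (𝓗.le _ _ hS)
      (fun t => (Measurable.tsum fun k => hofReal k t).ennreal_toReal)
      (fun ω _ => by simp [B, (hA _).bot]) (fun ω h s t hst => ?_) (fun ω h t => ?_)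
    · simp only [hB]
      exact (hsummable' h s).tsum_le_tsum (fun k => (hA k).mono ω hst) (hsummable' h t)
    · simp only [hB]
      refine tendsto_tsum_of_dominated_convergence (hsummable h)
        (fun k => (hA k).rightCont ω t) (.of_forall fun s k => ?_)
      rw [Real.norm_of_nonneg ((hA k).nonneg s ω)]
      exact (hA k).le_top s ω
  · intro s C hC
    have e1 (ω : Ω) : ENNReal.ofReal (V ⊤ ω - V s ω) =
        ∑' k, ENNReal.ofReal (levelPart V k ⊤ ω - levelPart V k s ω) := by
      have h := (hasSum_levelPart hV ⊤ ω).sub (hasSum_levelPart hV s ω)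
      rw [← ENNReal.ofReal_tsum_of_nonneg _ h.summable, h.tsum_eq]
      exact fun k => sub_nonneg.2 ((hV.levelPart k).le_top s ω)
    have e2 {ω : Ω} (hω : ω ∈ S) :
        ENNReal.ofReal (S.indicator (B ⊤) ω - S.indicator (B s) ω) =
        ∑' k, ENNReal.ofReal (A k ⊤ ω - A k s ω) := by
      have h := (hsummable' hω ⊤).hasSum.sub (hsummable' hω s).hasSum
      rw [← ENNReal.ofReal_tsum_of_nonneg _ h.summable, h.tsum_eq, Set.indicator_of_mem hω,
        Set.indicator_of_mem hω, hB, hB]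
      exact fun k => sub_nonneg.2 ((hA k).le_top s ω)
    have hm {W : TimeInterval T → Ω → ℝ} (hW : IsIncreasingProcess W) :
        AEMeasurable (fun ω => ENNReal.ofReal (W ⊤ ω - W s ω)) (P.restrict C) :=
      ((hW.meas ⊤).sub (hW.meas s)).ennreal_ofReal.aemeasurable
    simp only [e1]
    rw [lintegral_congr_ae (g := fun ω => ∑' k, ENNReal.ofReal (A k ⊤ ω - A k s ω))
      (ae_restrict_of_ae (hSae.mono fun ω hω => e2 hω)),
      lintegral_tsum fun k => hm (hV.levelPart k), lintegral_tsum fun k => hm (hA k)]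
    exact tsum_congr fun k => hAV k s C hC

lemma IsIncreasingProcess.isCadlag (hV : IsIncreasingProcess V) (ω : Ω) :
    IsCadlag fun t => V t ω := fun t =>
  ⟨hV.rightCont ω t, _, (hV.mono ω).tendsto_leftLim t⟩

end Existence

end PredictableDualProjection

/-! ### The predictable dual projection. -/

open PredictableDualProjection in
theorem proposition4p3 {Ω : Type*} {m : MeasurableSpace Ω} (P : Measure Ω)
    [IsProbabilityMeasure P] (T : ℝ≥0)
    (𝓕 𝓗 : Filtration (TimeInterval T) m) (h𝓕 : UsualHypotheses P 𝓕)
    (h𝓗 : UsualHypotheses P 𝓗) (h𝓗𝓕 : 𝓗 ≤ 𝓕)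
    (G : TimeInterval T → Ω → ℝ) (hGadapted : StronglyAdapted 𝓕 G)
    (hGcadlag : ∀ ω, IsCadlag fun t => G t ω) (hGvar : HasIntegrableVariation P G) :
    ∃ GH : TimeInterval T → Ω → ℝ,
      IsPredictableDualProjection P 𝓗 G GH ∧ (∀ ω, GH ⊥ ω = 0) ∧
        ∀ G' : TimeInterval T → Ω → ℝ, IsPredictableDualProjection P 𝓗 G G' →
          ∀ᵐ ω ∂P, ∀ t, G' t ω - G' ⊥ ω = GH t ω := by
  obtain ⟨p, n, hd⟩ := exists_isDecomposition
    (fun t => (hGadapted t).measurable.mono (𝓕.le t) le_rfl) (fun ω t => (hGcadlag ω t).1) hGvar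
  obtain ⟨A, hA, hAp, hAproj⟩ := exists_predictable_increasing h𝓗.complete hd.pos hd.integrable_pos
  obtain ⟨B, hB, hBp, hBproj⟩ := exists_predictable_increasing h𝓗.complete hd.neg hd.integrable_neg
  have hAi := hAproj.integrable_top hd.pos hA hd.integrable_pos
  have hBi := hBproj.integrable_top hd.neg hB hd.integrable_neg
  -- The compensators of the two parts need not form a minimal decomposition of their difference;
  -- any decomposition into integrable increasing processes computes the expected integrals.
  let GH : TimeInterval T → Ω → ℝ := fun t ω => A t ω - B t ω
  have hbot (ω) : GH ⊥ ω = 0 := by simp [GH, hA.bot, hB.bot]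
  have hdGH : IsDecomposition P GH A B :=
    ⟨hA, hB, hAi, hBi, .of_forall fun ω t => by simp only [hbot, sub_zero, GH]⟩
  have hGH : IsPredictableDualProjection P 𝓗 G GH := by
    refine ⟨?_, fun ω => (hA.isCadlag ω).sub (hB.isCadlag ω), ?_, ?_⟩
    · exact isStronglyPredictable_iff.2
        ((isStronglyPredictable_iff.1 hAp).sub (isStronglyPredictable_iff.1 hBp))
    · refine (lintegral_mono fun ω => eVariationOn_sub_le (hA.mono ω) (hB.mono ω)).trans_lt ?_
      simp only [hA.bot, hB.bot, sub_zero]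
      rw [lintegral_add_left (hA.meas ⊤).ennreal_ofReal]
      exact ENNReal.add_lt_top.2 ⟨hAi.lintegral_lt_top, hBi.lintegral_lt_top⟩
    · rintro φ hφ ⟨C, hC⟩
      rw [hdGH.integral_stieltjesIntegral hφ.stronglyMeasurable hC,
        hd.integral_stieltjesIntegral hφ.stronglyMeasurable hC,
        hAproj.integral_doleans hd.pos hA hd.integrable_pos hφ,
        hBproj.integral_doleans hd.neg hB hd.integrable_neg hφ]
  refine ⟨GH, hGH, hbot, fun G' hG' => ?_⟩
  have := ae_forall_sub_bot_eq hG'.predictable hGH.predictable hG'.cadlag hGH.cadlag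
    hG'.integrableVariation hGH.integrableVariation fun φ hφ hφ1 => by
      rw [hG'.expectation_eq φ hφ ⟨1, hφ1⟩, hGH.expectation_eq φ hφ ⟨1, hφ1⟩]
  filter_upwards [this] with ω hω t
  rw [hω t, hbot, sub_zero]
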